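/- A binary word is a finite word over the alphabet $\{0,1\}$; $|w|$ denotes the length of $w$. A border of a word $w$ is a nonempty word $y\neq w$ that is both a prefix and a suffix of $w$; a word is unbordered if it has no border. The conjugates of $w$ are the words $ba$ with $w=ab$. A binary word $w$ is fully bordered if $|w|>1$ and exactly two words are unbordered conjugates of $w$. A pair $(u,v)$ of binary words is fully bordered if $uv$ is fully bordered and its unbordered conjugates are exactly $uv$ and $vu$. For a nonempty word $w$, let $z$ be its periodic root, that is, the prefix of $w$ whose length is the smallest $p\ge 1$ with $w_{i+p}=w_i$ for all $1\le i\le |w|-p$. Write $w=z^{k}z'$ with $k\geq 0$ and $z'$ a nonempty prefix of $z$ (possibly $z'=z$), and put $s_w=z'$ and let $t_w$ be the word with $z=s_wt_w$; thus $w=(s_wt_w)^{k}s_w$ with $s_w$ nonempty. Let $\mathcal F$ be the smallest subset of $\{0,1\}^*\times\{0,1\}^*$ such that 1. $(0,1)\in\mathcal F$; 2. if $(u,v)\in\mathcal F$, then $(v,u)\in\mathcal F$; 3. if $(u,v)\in\mathcal F$, then $(s_ut_uu,v)\in\mathcal F$; 4. if $(u,v)\in\mathcal F$ and $y$ is a border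 of $u$ with $|t_v|<|y|$, then $(u,vyv)\in\mathcal F$. Theorem. A pair $(u,v)\in\{0,1\}^*\times\{0,1\}^*$ is fully bordered if and only if $(u,v)\in\mathcal F$. -/

import Mathlib

namespace BinaryWord

/-- Binary words: finite words over the alphabet `{0, 1}`. -/
abbrev Word : Type := List (Fin 2)

/-- `y` is a border of `w`: a nonempty word different from `w` that is both a prefix
and a suffix of `w` (occurrences may overlap). -/
def IsBorder (y w : Word) : Prop :=
  y ≠ [] ∧ y ≠ w ∧ y <+: w ∧ y <:+ w

/-- A word is unbordered if it has no border. -/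
def Unbordered (w : Word) : Prop :=
  ∀ y : Word, ¬ IsBorder y w

/-- The set of unbordered conjugates (cyclic rotations) of `w`; conjugates are counted as words. -/
def unborderedConjugates (w : Word) : Set Word :=
  {z | z ~r w ∧ Unbordered z}

/-- `w` is fully bordered: it has length greater than `1` and exactly two unbordered conjugates. -/
def FullyBordered (w : Word) : Prop :=
  1 < w.length ∧ (unborderedConjugates w).ncard = 2

/-- `(u, v)` is a fully bordered pair: `uv` is fully bordered, and its unbordered conjugates
are `uv` and `vu`. -/
def FullyBorderedPair (u v : Word) : Prop :=
  FullyBordered (u ++ v) ∧ unborderedConjugates (u ++ v) = {u ++ v, v ++ u}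

/-- The period of `w`: the smallest `p ≥ 1` such that `w_{i+p} = w_i` whenever both letters
exist. -/
noncomputable def period (w : Word) : ℕ :=
  sInf {p : ℕ | 1 ≤ p ∧ w.HasPeriod p}

/-- The periodic root of `w`: its prefix whose length is the period of `w`. -/
noncomputable def periodicRoot (w : Word) : Word :=
  w.take (period w)

/-- For nonempty `w` with periodic root `z`, the number `k_w` such that `w = z ^ k_w z'` with `z'` a
nonempty prefix of `z` (possibly `z' = z`). -/
noncomputable def kExp (w : Word) : ℕ :=
  (w.length - 1) / period w

/-- `s_w = z'`, where `w = z ^ k_w z'` as above. -/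
noncomputable def sPart (w : Word) : Word :=
  w.drop (kExp w * period w)

/-- `t_w = z'⁻¹ z`, so that `z = s_w t_w` and `w = (s_w t_w) ^ k_w s_w`. -/
noncomputable def tPart (w : Word) : Word :=
  (periodicRoot w).drop (sPart w).length

/-- Membership in the set `F`, the smallest set of pairs of binary words that contains `(0, 1)` and
is closed under the three operations below. -/
inductive InF : Word → Word → Prop
  | base : InF [0] [1]
  | swap {u v : Word} : InF u v → InF v u
  | root {u v : Word} : InF u v → InF (sPart u ++ tPart u ++ u) v
  | border {u v y : Word} : InF u v → IsBorder y u → (tPart v).length < y.length →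
      InF u (v ++ y ++ v)

end BinaryWord

namespace BinaryWord

/-! ### Factors -/

/-! Write v' for v with its first period removed. Both directions run through a local description of
fully bordered pairs. If no nonempty word is a prefix of one component and a suffix of the other,
and neither component is a factor of the other (`Sep`), then u v and v u are unbordered, and a
conjugate v₂ u v₁ with v = v₁ v₂ is bordered exactly when a local square of u v u is centred at the
cut v₁ | v₂. So being fully bordered means `Sep` together with `Filled` for (u, v) and (v, u).

From F to fully bordered, an invariant stronger than `Filled` is carried along (`Half`, `InF.inv`):
t_v is a prefix and a suffix of u, the squares at the cuts of v already fit in t_v v t_v, and no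
nonempty word that is both prefix and suffix of u and occurs in v is longer than t_v. The last
clause is what makes rule 4 produce a word of period |v y|.

Conversely, for the two orders on letters, u v and v u are the lexicographically largest conjugates.
A shortest square at the maximal suffix of v, as in the critical factorization theorem, reveals the
period of v; with its mirror image it identifies s_v and t_v and shows that t_v is the longest
border of u occurring in v (`Core`; t_v may be empty). If v' is not a factor of u, then (u, v') is
again fully bordered, and passing back from v' to v is rule 3 or rule 4 (`InF.of_drop`). The
obstruction cannot occur for both components (`not_both_infix`), so induction on |u| + |v| finishes.
-/

theorem append_overlap {a b x y : Word} (h : a ++ x = b ++ y) (hl : b.length < a.length) :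
    ∃ o, o ≠ [] ∧ a = b ++ o ∧ y = o ++ x := by
  rcases List.append_eq_append_iff.1 h with ⟨c, rfl, rfl⟩ | ⟨c, rfl, rfl⟩
  · simp at hl
  · refine ⟨c, ?_, rfl, rfl⟩
    rintro rfl; simp at hl

theorem append_overlap_le {a b x y : Word} (h : a ++ x = b ++ y) (hl : b.length ≤ a.length) :
    ∃ o, a = b ++ o ∧ y = o ++ x := by
  rcases List.append_eq_append_iff.1 h with ⟨c, rfl, rfl⟩ | ⟨c, rfl, rfl⟩
  · have : c = [] := by simpa using hl
    subst this; exact ⟨[], by simp⟩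
  · exact ⟨c, rfl, rfl⟩

theorem exists_overlap {a b w : Word} (ha : a <+: w) (hb : b <:+ w)
    (h : w.length < a.length + b.length) :
    ∃ o, o ≠ [] ∧ o.length + w.length = a.length + b.length ∧ o <:+ a ∧ o <+: b := by
  obtain ⟨x, hx⟩ := ha
  obtain ⟨y, hy⟩ := hb
  have hl : y.length < a.length := by
    have := congrArg List.length hy; simp at this; omega
  obtain ⟨o, ho, h1, h2⟩ := append_overlap (hx.trans hy.symm) hl
  refine ⟨o, ho, ?_, ⟨y, h1.symm⟩, ⟨x, h2.symm⟩⟩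
  simp [← hx, h1, h2]; omega

theorem prefix_append_cases {x a b : Word} (h : x <+: a ++ b) :
    x <+: a ∨ ∃ c, c ≠ [] ∧ x = a ++ c ∧ c <+: b := by
  obtain ⟨t, ht⟩ := h
  rcases le_or_gt x.length a.length with hl | hl
  · obtain ⟨o, ho, -⟩ := append_overlap_le ht.symm hl
    exact .inl ⟨o, ho.symm⟩
  · obtain ⟨o, h1, h2, h3⟩ := append_overlap ht hl
    exact .inr ⟨o, h1, h2, ⟨t, h3.symm⟩⟩

theorem suffix_append_cases {x a b : Word} (h : x <:+ a ++ b) :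
    x <:+ b ∨ ∃ c, c ≠ [] ∧ x = c ++ b ∧ c <:+ a := by
  have h' : x.reverse <+: b.reverse ++ a.reverse := by simpa using List.reverse_prefix.2 h
  rcases prefix_append_cases h' with h | ⟨c, h1, h2, h3⟩
  · exact .inl (List.reverse_prefix.1 h)
  · refine .inr ⟨c.reverse, by simpa using h1, ?_, ?_⟩
    · simpa using congrArg List.reverse h2
    · simpa using List.reverse_suffix.2 h3

theorem eq_of_prefix_of_length {a b w : Word} (ha : a <+: w) (hb : b <+: w)
    (h : a.length = b.length) : a = b :=
  (List.prefix_of_prefix_length_le ha hb h.le).eq_of_length h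

theorem eq_of_suffix_of_length {a b w : Word} (ha : a <:+ w) (hb : b <:+ w)
    (h : a.length = b.length) : a = b :=
  (List.suffix_of_suffix_length_le ha hb h.le).eq_of_length h

/-! ### Borders -/

theorem IsBorder.length_lt {y w : Word} (h : IsBorder y w) : y.length < w.length :=
  lt_of_le_of_ne h.2.2.1.length_le fun e => h.2.1 (h.2.2.1.eq_of_length e)

theorem IsBorder.reverse {y w : Word} (h : IsBorder y w) : IsBorder y.reverse w.reverse :=
  ⟨by simpa using h.1, by simpa using h.2.1, List.reverse_prefix.2 h.2.2.2,
    List.reverse_suffix.2 h.2.2.1⟩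

theorem isBorder_of_append {x a b w : Word} (hx : x ≠ []) (ha : a ≠ []) (h1 : w = x ++ a)
    (h2 : w = b ++ x) : IsBorder x w :=
  ⟨hx, by rintro rfl; simp at h1; exact ha h1, ⟨a, h1.symm⟩, ⟨b, h2.symm⟩⟩

/-- A bordered word has a border whose two occurrences do not overlap. -/
theorem exists_short_border {w : Word} (h : ¬ Unbordered w) :
    ∃ y, IsBorder y w ∧ 2 * y.length ≤ w.length := by
  have hex : ∃ n y, IsBorder y w ∧ y.length = n := by
    simp only [Unbordered, not_forall, not_not] at h
    obtain ⟨y, hy⟩ := h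
    exact ⟨_, y, hy, rfl⟩
  classical
  obtain ⟨y, hy, hn⟩ := Nat.find_spec hex
  refine ⟨y, hy, ?_⟩
  by_contra hlt
  obtain ⟨o, ho, hl, h1, h2⟩ := exists_overlap hy.2.2.1 hy.2.2.2 (by omega)
  have := hy.length_lt
  have := Nat.find_min hex (m := o.length) (by omega)
  exact this ⟨o, ⟨ho, fun e => by have := hy.length_lt; subst e; omega, h2.trans hy.2.2.1,
    h1.trans hy.2.2.2⟩, rfl⟩

/-! ### Separated pairs and local squares -/

/-- No nonempty word is a prefix of one component and a suffix of the other, and neither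
component is a factor of the other. -/
structure Sep (u v : Word) : Prop where
  ps : ∀ x, x <+: u → x <:+ v → x = []
  sp : ∀ x, x <:+ u → x <+: v → x = []
  left : ¬ u <:+: v
  right : ¬ v <:+: u

namespace Sep
variable {u v : Word}

theorem symm (h : Sep u v) : Sep v u :=
  ⟨fun x a b => h.sp x b a, fun x a b => h.ps x b a, h.right, h.left⟩

theorem reverse (h : Sep u v) : Sep u.reverse v.reverse := by
  refine ⟨fun x a b => ?_, fun x a b => ?_, by simpa using h.left, by simpa using h.right⟩
  · have := h.sp x.reverse (List.reverse_prefix.1 (by simpa using a))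
      (List.reverse_suffix.1 (by simpa using b))
    simpa using this
  · have := h.ps x.reverse (List.reverse_suffix.1 (by simpa using a))
      (List.reverse_prefix.1 (by simpa using b))
    simpa using this

theorem left_ne_nil (h : Sep u v) : u ≠ [] := fun e => h.left (e ▸ List.nil_infix)

theorem right_ne_nil (h : Sep u v) : v ≠ [] := h.symm.left_ne_nil

/-- A border whose occurrences do not overlap cannot be longer than both u and v; every other
position of it is excluded by a field of `Sep`. -/
theorem unbordered (h : Sep u v) : Unbordered (u ++ v) := by
  by_contra hb
  obtain ⟨y, hy, hl⟩ := exists_short_border hb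
  have hlt := hy.length_lt
  simp only [List.length_append] at hl
  rcases prefix_append_cases hy.2.2.1 with h1 | ⟨c, hc, h1, h2⟩
  · rcases suffix_append_cases hy.2.2.2 with h3 | ⟨d, hd, h3, h4⟩
    · exact hy.1 (h.ps y h1 h3)
    · exact h.right (List.IsInfix.trans ⟨d, [], by simp [h3]⟩ h1.isInfix)
  · rcases suffix_append_cases hy.2.2.2 with h3 | ⟨d, hd, h3, h4⟩
    · exact h.left (List.IsInfix.trans ⟨[], c, by simp [h1]⟩ h3.isInfix)
    · have e1 := congrArg List.length h1
      have e2 := congrArg List.length h3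
      have := List.length_pos_iff.2 hc
      have := List.length_pos_iff.2 hd
      simp at e1 e2
      omega

end Sep

/-- A nonempty word occurs on both sides of the centre of `a v₁ | v₂ a`. -/
def Sq (a v₁ v₂ : Word) : Prop :=
  ∃ x, x ≠ [] ∧ x <+: v₂ ++ a ∧ x <:+ a ++ v₁

theorem Sq.reverse {a v₁ v₂ : Word} (h : Sq a v₁ v₂) : Sq a.reverse v₂.reverse v₁.reverse := by
  obtain ⟨x, hx, h1, h2⟩ := h
  exact ⟨x.reverse, by simpa using hx, by simpa using List.reverse_prefix.2 h2,
    by simpa using List.reverse_suffix.2 h1⟩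

/-- A shortest square works: a border of it would be a shorter square at the same centre. -/
theorem Sq.exists_unbordered {a v₁ v₂ : Word} (h : Sq a v₁ v₂) :
    ∃ x, x ≠ [] ∧ x <+: v₂ ++ a ∧ x <:+ a ++ v₁ ∧ Unbordered x := by
  have hex : ∃ n x, (x ≠ [] ∧ x <+: v₂ ++ a ∧ x <:+ a ++ v₁) ∧ x.length = n := by
    obtain ⟨x, hx⟩ := h
    exact ⟨_, x, hx, rfl⟩
  classical
  obtain ⟨x, hx, hn⟩ := Nat.find_spec hex
  refine ⟨x, hx.1, hx.2.1, hx.2.2, fun y hy => ?_⟩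
  have := hy.length_lt
  exact Nat.find_min hex (m := y.length) (by omega)
    ⟨y, ⟨hy.1, hy.2.2.1.trans hx.2.1, hy.2.2.2.trans hx.2.2⟩, rfl⟩

/-- Every inner position of `v` is the centre of a local square of `u v u`. -/
def Filled (u v : Word) : Prop :=
  ∀ v₁ v₂, v = v₁ ++ v₂ → v₁ ≠ [] → v₂ ≠ [] → Sq u v₁ v₂

theorem Filled.reverse {u v : Word} (h : Filled u v) : Filled u.reverse v.reverse := by
  intro v₁ v₂ e h1 h2
  have := (h v₂.reverse v₁.reverse (by simpa using congrArg List.reverse e) (by simpa using h2)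
    (by simpa using h1)).reverse
  simpa using this

/-- A short border reaching beyond v₂ u would put a copy of u inside v₁, and symmetrically on the
other side inside v₂. So a short border is itself a local square. -/
theorem Sep.bordered_iff_sq {u v v₁ v₂ : Word} (h : Sep u v) (hv : v = v₁ ++ v₂) (h1 : v₁ ≠ []) : ¬ Unbordered (v₂ ++ u ++ v₁) ↔ Sq u v₁ v₂ := by
  subst hv
  constructor
  · intro hb
    obtain ⟨y, hy, hl⟩ := exists_short_border hb
    obtain ⟨z, hz⟩ := hy.2.2.2
    obtain ⟨w, hw⟩ := hy.2.2.1
    have hle : y.length ≤ z.length := by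
      have := congrArg List.length hz; simp at this hl; omega
    have hle' : y.length ≤ w.length := by
      have := congrArg List.length hw; simp at this hl; omega
    refine ⟨y, hy.1, ?_, ?_⟩
    · rcases prefix_append_cases hy.2.2.1 with h3 | ⟨c, hc, h3, h4⟩
      · exact h3
      · exfalso
        -- the suffix occurrence of `y` lies inside `v₁`
        have : y <:+ v₁ := by
          refine List.suffix_of_suffix_length_le hy.2.2.2 (List.suffix_append _ _) ?_
          have e1 := congrArg List.length hz
          have e2 := congrArg List.length h3
          simp at e1 e2
          omega
        refine h.left (List.IsInfix.trans ?_ (this.isInfix.trans List.infix_append_left))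
        exact ⟨v₂, c, by simp [h3]⟩
    · have h5 : y <:+ v₂ ++ (u ++ v₁) := by simpa using hy.2.2.2
      rcases suffix_append_cases h5 with h3 | ⟨c, hc, h3, h4⟩
      · exact h3
      · exfalso
        have : y <+: v₂ := by
          refine List.prefix_of_prefix_length_le hy.2.2.1 ⟨u ++ v₁, by simp⟩ ?_
          have e1 := congrArg List.length hw
          have e2 := congrArg List.length h3
          simp at e1 e2
          omega
        refine h.left (List.IsInfix.trans ?_ (this.isInfix.trans List.infix_append_right))
        exact ⟨c, v₁, by simp [h3]⟩
  · rintro ⟨x, hx, h3, h4⟩ hu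
    refine hu x ⟨hx, ?_, h3.trans (List.prefix_append _ _), ?_⟩
    · rintro rfl
      have := h3.length_le
      have := List.length_pos_iff.2 h1
      simp only [List.length_append] at *
      omega
    · exact h4.trans ⟨v₂, by simp⟩

/-! ### Lexicographic dominance -/

/-- `Dom c a b`: the word `a` is lexicographically at least `b` for the order on letters in which
`c` is the largest. -/
def Dom (c : Fin 2) : Word → Word → Prop
  | _, [] => True
  | [], _ :: _ => False
  | x :: a, y :: b => (x = c ∧ y ≠ c) ∨ (x = y ∧ Dom c a b)

namespace Dom
variable {c d : Fin 2} {a b e g : Word}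

@[simp] theorem nil_right : Dom c a [] := by cases a <;> simp [Dom]

@[simp] theorem nil_left : Dom c [] a ↔ a = [] := by cases a <;> simp [Dom]

theorem refl (c : Fin 2) (a : Word) : Dom c a a := by
  induction a with
  | nil => simp
  | cons x a ih => exact .inr ⟨rfl, ih⟩

theorem trans : ∀ {a b e : Word}, Dom c a b → Dom c b e → Dom c a e
  | _, _, [], _, _ => by simp
  | _, [], _ :: _, _, h => by simp [Dom] at h
  | [], _ :: _, _ :: _, h, _ => by simp [Dom] at h
  | x :: a, y :: b, z :: e, h1, h2 => by
    rcases h1 with ⟨rfl, h1⟩ | ⟨rfl, h1⟩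
    · rcases h2 with ⟨rfl, h2⟩ | ⟨rfl, h2⟩
      · exact absurd rfl h1
      · exact .inl ⟨rfl, h1⟩
    · rcases h2 with ⟨rfl, h2⟩ | ⟨rfl, h2⟩
      · exact .inl ⟨rfl, h2⟩
      · exact .inr ⟨rfl, trans h1 h2⟩

theorem total (c : Fin 2) : ∀ a b : Word, Dom c a b ∨ Dom c b a
  | _, [] => by simp
  | [], _ :: _ => by simp
  | x :: a, y :: b => by
    by_cases hxy : x = y
    · subst hxy
      rcases total c a b with h | h
      · exact .inl (.inr ⟨rfl, h⟩)
      · exact .inr (.inr ⟨rfl, h⟩)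
    · by_cases hx : x = c
      · exact .inl (.inl ⟨hx, fun h => hxy (hx.trans h.symm)⟩)
      · exact .inr (.inl ⟨by omega, hx⟩)

theorem antisymm : ∀ {a b : Word}, Dom c a b → Dom c b a → a = b
  | [], [], _, _ => rfl
  | _ :: _, [], _, h => by simp at h
  | [], _ :: _, h, _ => by simp at h
  | x :: a, y :: b, h1, h2 => by
    rcases h1 with ⟨rfl, h1⟩ | ⟨rfl, h1⟩
    · rcases h2 with ⟨rfl, h2⟩ | ⟨rfl, h2⟩
      · exact absurd rfl h1
      · exact absurd rfl h1
    · rcases h2 with ⟨rfl, h2⟩ | ⟨-, h2⟩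
      · exact absurd rfl h2
      · rw [antisymm h1 h2]

@[simp] theorem append_left_iff : Dom c (g ++ a) (g ++ b) ↔ Dom c a b := by
  induction g with
  | nil => simp
  | cons x g ih =>
    simp only [List.cons_append, Dom, ih]
    constructor
    · rintro (⟨h1, h2⟩ | ⟨-, h⟩)
      · exact absurd h1 h2
      · exact h
    · exact fun h => .inr ⟨trivial, h⟩

theorem of_prefix (h : b <+: a) : Dom c a b := by
  obtain ⟨t, rfl⟩ := h
  simpa using (append_left_iff (c := c) (g := b) (a := t) (b := [])).2 nil_right

theorem trunc {A B : Word} (h : Dom c A B) (ha : a <+: A) (hb : b <+: B)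
    (hl : b.length ≤ a.length) : Dom c a b := by
  replace h : Dom c A b := h.trans (of_prefix hb)
  clear hb B
  induction a generalizing A b with
  | nil => obtain rfl : b = [] := by simpa using hl
           simp
  | cons x a ih =>
    cases b with
    | nil => simp
    | cons y b =>
      obtain ⟨t, rfl⟩ := ha
      rcases h with h | ⟨h1, h2⟩
      · exact .inl h
      · exact .inr ⟨h1, ih ⟨t, rfl⟩ (by simpa using hl) h2⟩

theorem eq_of_squeeze {A B : Word} (h1 : Dom c A e) (h2 : Dom c e B) (ha : a <+: A)
    (hb : a <+: B) : a <+: e := by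
  have h3 : Dom c e a := h2.trans (of_prefix hb)
  rcases le_total a.length e.length with hl | hl
  · have h4 := h1.trunc ha (e.take_prefix a.length) (by simp)
    have h5 := h3.trunc (e.take_prefix a.length) (List.prefix_refl a) (by simp [hl])
    rw [h4.antisymm h5]
    exact e.take_prefix _
  · have h4 := h1.trunc ha (List.prefix_refl e) hl
    rw [h4.antisymm h3]

/-- At a first mismatch the two orders on a binary alphabet disagree, so there is none. -/
theorem prefix_of_dom (hcd : c ≠ d) : ∀ {a b : Word}, Dom c a b → Dom d a b → b <+: a
  | _, [], _, _ => by simp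
  | [], _ :: _, h, _ => by simp at h
  | x :: a, y :: b, h1, h2 => by
    rcases h1 with ⟨rfl, h1⟩ | ⟨rfl, h1⟩
    · rcases h2 with ⟨rfl, h2⟩ | ⟨rfl, h2⟩
      · exact absurd rfl hcd
      · exact absurd rfl h1
    · rcases h2 with ⟨rfl, h2⟩ | ⟨-, h2⟩
      · exact absurd rfl h2
      · exact (List.prefix_cons_inj x).2 (prefix_of_dom hcd h1 h2)

theorem prefix_of_dom_of_prefix (hcd : c ≠ d) {A : Word} (h1 : Dom c a b) (ha : a <+: A)
    (h2 : Dom d A b) : b <+: a := by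
  have h3 := prefix_of_dom hcd ((of_prefix ha).trans h1) h2
  rcases List.prefix_or_prefix_of_prefix h3 ha with h | h
  · exact h
  · rw [h1.antisymm (of_prefix h)]

end Dom

theorem exists_dom_max (c : Fin 2) : ∀ {L : List Word}, L ≠ [] → ∃ m ∈ L, ∀ w ∈ L, Dom c m w
  | [], h => absurd rfl h
  | [x], _ => ⟨x, by simp, by simp [Dom.refl]⟩
  | x :: y :: L, _ => by
    obtain ⟨m, hm, hmax⟩ := exists_dom_max c (L := y :: L) (by simp)
    rcases Dom.total c x m with h | h
    · exact ⟨x, by simp, fun w hw => (List.mem_cons.1 hw).elim (fun e => e ▸ Dom.refl c _)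
        fun hw => h.trans (hmax w hw)⟩
    · exact ⟨m, List.mem_cons_of_mem _ hm, fun w hw => (List.mem_cons.1 hw).elim
        (fun e => e ▸ h) (hmax w)⟩

/-! ### Rotations -/

theorem isRotated_iff_append {r w : Word} : r ~r w ↔ ∃ a b, w = a ++ b ∧ r = b ++ a := by
  constructor
  · intro h
    obtain ⟨n, hn, rfl⟩ := List.isRotated_iff_mod.1 h.symm
    exact ⟨w.take n, w.drop n, by simp, List.rotate_eq_drop_append_take hn⟩
  · rintro ⟨a, b, rfl, rfl⟩
    exact List.isRotated_append

theorem not_unbordered_of_comm {x y : Word} (hx : x ≠ []) (hy : y ≠ []) (h : x ++ y = y ++ x) :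
    ¬ Unbordered (x ++ y) := fun hu => hu x (isBorder_of_append hx hy rfl h)

theorem not_unbordered_of_isRotated {x y z : Word} (hx : x ≠ []) (hy : y ≠ [])
    (h : x ++ y = y ++ x) (hz : z ~r x ++ y) : ¬ Unbordered z := by
  obtain ⟨n, hn⟩ := hz.symm
  have h1 : z.rotate x.length = z := by
    rw [← hn, List.rotate_rotate, add_comm, ← List.rotate_rotate, List.rotate_append_length_eq, h]
  have hl : x.length ≤ z.length := by rw [hz.perm.length_eq]; simp
  rw [List.rotate_eq_drop_append_take hl] at h1
  have h2 := not_unbordered_of_comm (x := z.take x.length) (y := z.drop x.length) ?_ ?_ ?_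
  · simpa using h2
  · intro e; have := congrArg List.length e
    have := List.length_pos_iff.2 hx
    simp only [List.length_take, List.length_nil] at *; omega
  · intro e; have := congrArg List.length e
    have := List.length_pos_iff.2 hy
    have := hz.perm.length_eq
    simp only [List.length_append, List.length_drop, List.length_nil] at *; omega
  · rw [h1]; simp

/-- If m = g a = b g, comparing m with its conjugates g b and a g gives a = b. Then g and a commute,
and no conjugate of m is unbordered. -/
theorem unbordered_of_dom {c : Fin 2} {w m z : Word} (hm : m ~r w)
    (hmax : ∀ r, r ~r w → Dom c m r) (hz : z ~r w) (hu : Unbordered z) : Unbordered m := by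
  intro g hg
  obtain ⟨a, ha⟩ := hg.2.2.1
  obtain ⟨b, hb⟩ := hg.2.2.2
  have hab : a.length = b.length := by
    have := congrArg List.length (ha.trans hb.symm); simp at this; omega
  have h1 : Dom c a b := by
    have := hmax (g ++ b) ((List.isRotated_append (l := g) (l' := b)).trans (hb ▸ hm))
    rwa [← ha, Dom.append_left_iff] at this
  have h2 : Dom c b a := by
    have := hmax (a ++ g) ((List.isRotated_append (l := a) (l' := g)).trans (ha ▸ hm))
    rw [← hb] at this
    exact this.trunc (List.prefix_append _ _) (List.prefix_append _ _) hab.le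
  obtain rfl := h1.antisymm h2
  refine not_unbordered_of_isRotated hg.1 ?_ (ha.trans hb.symm) ((hz.trans hm.symm).trans
    (by rw [ha])) hu
  rintro rfl
  exact hg.2.1 (by simpa using ha)

/-! ### Fully bordered pairs through local squares -/

/-- The conjugate `u v` is lexicographically the largest for the letter `c`, and `v u` for the
other letter `d`. -/
structure Extremal (c d : Fin 2) (u v : Word) : Prop where
  ne : c ≠ d
  left_max : ∀ r, r ~r u ++ v → Dom c (u ++ v) r
  right_max : ∀ r, r ~r u ++ v → Dom d (v ++ u) r
  left_head : [c] <+: u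
  right_head : [d] <+: v

theorem Extremal.symm {c d : Fin 2} {u v : Word} (h : Extremal c d u v) : Extremal d c v u :=
  ⟨h.ne.symm, fun r hr => h.right_max r (hr.trans List.isRotated_append),
    fun r hr => h.left_max r (hr.trans List.isRotated_append), h.right_head, h.left_head⟩

theorem exists_rotation_max (c : Fin 2) (w : Word) :
    ∃ m, m ~r w ∧ ∀ r, r ~r w → Dom c m r := by
  obtain ⟨m, hm, h⟩ := exists_dom_max c (L := w.cyclicPermutations) (by simp)
  exact ⟨m, List.mem_cyclicPermutations_iff.1 hm,
    fun r hr => h r (List.mem_cyclicPermutations_iff.2 hr)⟩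

theorem Dom.head {c x : Fin 2} {a b : Word} (h : Dom c (x :: a) (c :: b)) : x = c := by
  rcases h with ⟨h, -⟩ | ⟨h, -⟩ <;> exact h

theorem head_eq_of_rotation_max {c d : Fin 2} {w m m' : Word} (hm : m ~r w) (hm' : m' ~r w)
    (hmax : ∀ r, r ~r w → Dom c m r) (hcd : c ≠ d) (hne : m ≠ m') : [c] <+: m := by
  by_cases hc : c ∈ m
  · obtain ⟨s, t, hst⟩ := List.append_of_mem hc
    have hd := hmax (c :: t ++ s) ((by rw [hst]; exact List.isRotated_append :
      (c :: t ++ s) ~r m).trans hm)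
    rcases m with _ | ⟨x, m⟩
    · simp at hc
    · obtain rfl := Dom.head hd
      simp
  · exfalso
    have hrep : ∀ z : Word, z ~r m → z = List.replicate m.length d := fun z hz => by
      rw [← hz.perm.length_eq]
      refine List.eq_replicate_iff.2 ⟨rfl, fun x hx => ?_⟩
      have : x ≠ c := fun e => hc (e ▸ (hz.mem_iff.1 hx))
      omega
    exact hne ((hrep m (List.IsRotated.refl m)).trans (hrep m' (hm'.trans hm.symm)).symm)

theorem unborderedConjugates_congr {w w' : Word} (h : w ~r w') :
    unborderedConjugates w = unborderedConjugates w' := by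
  ext z
  exact ⟨fun hz => ⟨hz.1.trans h, hz.2⟩, fun hz => ⟨hz.1.trans h.symm, hz.2⟩⟩

namespace FullyBorderedPair
variable {u v : Word}

theorem ne (h : FullyBorderedPair u v) : u ++ v ≠ v ++ u := by
  intro e
  have h1 := h.1.2
  rw [h.2, e] at h1
  simp at h1

theorem left_ne_nil (h : FullyBorderedPair u v) : u ≠ [] := by
  rintro rfl; exact h.ne (by simp)

theorem right_ne_nil (h : FullyBorderedPair u v) : v ≠ [] := by
  rintro rfl; exact h.ne (by simp)

theorem unbordered (h : FullyBorderedPair u v) : Unbordered (u ++ v) := by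
  have : u ++ v ∈ unborderedConjugates (u ++ v) := by rw [h.2]; simp
  exact this.2

theorem unbordered' (h : FullyBorderedPair u v) : Unbordered (v ++ u) := by
  have : v ++ u ∈ unborderedConjugates (u ++ v) := by rw [h.2]; simp
  exact this.2

theorem eq_or_eq (h : FullyBorderedPair u v) {z : Word} (hz : z ~r u ++ v) (hu : Unbordered z) :
    z = u ++ v ∨ z = v ++ u := by
  have : z ∈ unborderedConjugates (u ++ v) := ⟨hz, hu⟩
  rw [h.2] at this
  simpa using this

theorem symm (h : FullyBorderedPair u v) : FullyBorderedPair v u := by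
  have e := unborderedConjugates_congr (List.isRotated_append (l := v) (l' := u))
  refine ⟨⟨?_, ?_⟩, ?_⟩
  · have := h.1.1; simp at this ⊢; omega
  · rw [e]; exact h.1.2
  · rw [e, h.2, Set.pair_comm]

theorem exists_extremal (h : FullyBorderedPair u v) : ∃ c d, Extremal c d u v := by
  obtain ⟨m, hm, hmax⟩ := exists_rotation_max 0 (u ++ v)
  obtain ⟨m', hm', hmax'⟩ := exists_rotation_max 1 (u ++ v)
  have hu := h.eq_or_eq hm (unbordered_of_dom hm hmax (List.IsRotated.refl _) h.unbordered)
  have hu' := h.eq_or_eq hm' (unbordered_of_dom hm' hmax' (List.IsRotated.refl _) h.unbordered)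
  have hne : m ≠ m' := by
    rintro rfl
    refine h.ne ?_
    have key : ∀ z, z ~r u ++ v → m = z := fun z hz => by
      have h1 := Dom.prefix_of_dom (by decide) (hmax z hz) (hmax' z hz)
      exact (h1.eq_of_length (hz.perm.length_eq.trans hm.perm.length_eq.symm)).symm
    exact (key _ (List.IsRotated.refl _)).symm.trans (key _ List.isRotated_append)
  have hh := head_eq_of_rotation_max hm hm' hmax (show (0 : Fin 2) ≠ 1 by decide) hne
  have hh' := head_eq_of_rotation_max hm' hm hmax' (show (1 : Fin 2) ≠ 0 by decide) hne.symm
  have aux : ∀ {x : Fin 2} {a b : Word}, a ≠ [] → [x] <+: a ++ b → [x] <+: a := by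
    intro x a b ha hx
    exact List.prefix_of_prefix_length_le hx (List.prefix_append _ _)
      (by simpa [Nat.one_le_iff_ne_zero] using ha)
  rcases hu with rfl | rfl <;> rcases hu' with rfl | rfl
  · exact absurd rfl hne
  · exact ⟨0, 1, by decide, hmax, hmax', aux h.left_ne_nil hh, aux h.right_ne_nil hh'⟩
  · exact ⟨1, 0, by decide, hmax', hmax, aux h.left_ne_nil hh', aux h.right_ne_nil hh⟩
  · exact absurd rfl hne

theorem not_infix_of_extremal {c d : Fin 2} (he : Extremal c d u v) (hu : Unbordered (u ++ v)) :
    ¬ u <:+: v := by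
  rintro ⟨s, t, hst⟩
  -- `v = s u t`, and the rotations starting at `u t` and at `t` force `v = t u s`
  have h1 : Dom c v (t ++ u ++ s) := by
    have := he.left_max (u ++ (t ++ u ++ s)) (by
      have : (u ++ t) ++ (u ++ s) ~r (u ++ s) ++ (u ++ t) := List.isRotated_append
      simpa [← hst] using this)
    simpa using this
  have h2 : Dom d v (t ++ u ++ s) := by
    have := he.right_max (t ++ u ++ s ++ u) (by
      have : t ++ (u ++ s ++ u) ~r (u ++ s ++ u) ++ t := List.isRotated_append
      simpa [← hst] using this)
    exact this.trunc (List.prefix_append _ _) (List.prefix_append _ _) (by simp [← hst]; omega)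
  have h3 := (Dom.prefix_of_dom he.ne h1 h2).eq_of_length (by simp [← hst]; omega)
  have hune : u ≠ [] := by
    rintro rfl
    have := he.left_head
    simp at this
  refine not_unbordered_of_comm (x := u ++ s) (y := u ++ t) (by simp [hune]) (by simp [hune]) ?_ ?_
  · have : u ++ v = u ++ (t ++ u ++ s) := by rw [h3]
    simpa [← hst] using this
  · simpa [← hst] using hu

theorem sep (h : FullyBorderedPair u v) : Sep u v := by
  obtain ⟨c, d, he⟩ := h.exists_extremal
  have hu := List.length_pos_iff.2 h.left_ne_nil
  have hv := List.length_pos_iff.2 h.right_ne_nil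
  refine ⟨fun x h1 h2 => ?_, fun x h1 h2 => ?_,
    not_infix_of_extremal he h.unbordered,
    not_infix_of_extremal he.symm h.unbordered'⟩
  · by_contra hx
    refine h.unbordered x ⟨hx, fun e => ?_, h1.trans (List.prefix_append _ _),
      h2.trans (List.suffix_append _ _)⟩
    have := h1.length_le
    have := congrArg List.length e
    simp only [List.length_append] at this
    omega
  · by_contra hx
    refine h.unbordered' x ⟨hx, fun e => ?_, h2.trans (List.prefix_append _ _),
      h1.trans (List.suffix_append _ _)⟩
    have := h1.length_le
    have := congrArg List.length e
    simp only [List.length_append] at this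
    omega

theorem filled (h : FullyBorderedPair u v) : Filled u v := by
  intro v₁ v₂ e h1 h2
  rw [← h.sep.bordered_iff_sq e h1]
  intro hu
  subst e
  have hr : v₂ ++ u ++ v₁ ~r u ++ (v₁ ++ v₂) := by
    have : v₂ ++ (u ++ v₁) ~r (u ++ v₁) ++ v₂ := List.isRotated_append
    simpa using this
  rcases h.eq_or_eq hr hu with e | e
  · refine not_unbordered_of_comm (x := u ++ v₁) (y := v₂) (by simp [h1]) h2 ?_ ?_
    · simpa using e.symm
    · simpa using h.unbordered
  · refine not_unbordered_of_comm (x := v₁) (y := v₂ ++ u) h1 (by simp [h2]) ?_ ?_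
    · simpa using e.symm
    · simpa using h.unbordered'

end FullyBorderedPair

theorem fullyBorderedPair_of_sep {u v : Word} (h : Sep u v) (h1 : Filled u v) (h2 : Filled v u) :
    FullyBorderedPair u v := by
  have hu := h.left_ne_nil
  have hv := h.right_ne_nil
  have hne : u ++ v ≠ v ++ u := fun e => not_unbordered_of_comm hu hv e h.unbordered
  have key : unborderedConjugates (u ++ v) = {u ++ v, v ++ u} := by
    ext z
    simp only [unborderedConjugates, Set.mem_ofPred_eq, Set.mem_insert_iff, Set.mem_singleton_iff]
    constructor
    · rintro ⟨hz, hzu⟩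
      obtain ⟨a, b, hab, rfl⟩ := isRotated_iff_append.1 hz
      by_contra hc
      push Not at hc
      rcases List.append_eq_append_iff.1 hab with ⟨v₁, rfl, rfl⟩ | ⟨u₂, rfl, rfl⟩
      · refine (h.bordered_iff_sq rfl ?_).2 (h1 v₁ b rfl ?_ ?_) (by simpa using hzu)
        · rintro rfl; simp at hc
        · rintro rfl; simp at hc
        · rintro rfl; simp at hc
      · refine (h.symm.bordered_iff_sq rfl ?_).2 (h2 a u₂ rfl ?_ ?_) (by simpa using hzu)
        · rintro rfl; simp at hc
        · rintro rfl; simp at hc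
        · rintro rfl; simp at hc
    · rintro (rfl | rfl)
      · exact ⟨List.IsRotated.refl _, h.unbordered⟩
      · exact ⟨List.isRotated_append, h.symm.unbordered⟩
  refine ⟨⟨?_, ?_⟩, key⟩
  · have := List.length_pos_iff.2 hu
    have := List.length_pos_iff.2 hv
    simp; omega
  · rw [key, Set.ncard_pair hne]

/-- The last letter of u cannot be d, since v begins with d. Hence the same order serves the pair
and its reversal, which later allows mirrored arguments. -/
theorem Extremal.unique {c d c' d' : Fin 2} {u v : Word} (hs : Sep u v)
    (h : Extremal c d u v) (h' : Extremal c' d' u.reverse v.reverse) : c' = c ∧ d' = d := by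
  have h1 : [c'] <:+ u := by simpa using List.reverse_suffix.2 h'.left_head
  have h3 : c' ≠ d := by
    rintro rfl
    simpa using hs.sp _ h1 h.right_head
  have := h.ne
  have := h'.ne
  omega

namespace FullyBorderedPair
variable {u v : Word}

theorem reverse (h : FullyBorderedPair u v) : FullyBorderedPair u.reverse v.reverse :=
  fullyBorderedPair_of_sep h.sep.reverse h.filled.reverse h.symm.filled.reverse

theorem exists_extremal_both (h : FullyBorderedPair u v) :
    ∃ c d, Extremal c d u v ∧ Extremal c d u.reverse v.reverse := by
  obtain ⟨c, d, he⟩ := h.exists_extremal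
  obtain ⟨c', d', he'⟩ := h.reverse.exists_extremal
  obtain ⟨rfl, rfl⟩ := Extremal.unique h.sep he he'
  exact ⟨c', d', he, he'⟩

end FullyBorderedPair

/-! ### Periods -/

theorem hasPeriod_of_append {w a r b : Word} (h1 : w = a ++ r) (h2 : w = r ++ b) :
    w.HasPeriod a.length := by
  unfold List.HasPeriod
  conv_rhs => rw [h1]
  rw [List.take_append_of_le_length le_rfl, List.take_length]
  conv_lhs => rw [h1]
  exact (List.prefix_append_right_inj a).2 ⟨b, h2.symm.trans h1⟩

theorem _root_.List.HasPeriod.exists_append {w : Word} {p : ℕ} (h : w.HasPeriod p)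
    (hp : p ≤ w.length) : ∃ a b r, w = a ++ r ∧ w = r ++ b ∧ a.length = p ∧ b.length = p := by
  obtain ⟨b, hb⟩ := h.drop_prefix
  refine ⟨w.take p, b, w.drop p, by simp, hb.symm, by simp [hp], ?_⟩
  have := congrArg List.length hb
  simp at this; omega

theorem _root_.List.HasPeriod.reverse {w : Word} {p : ℕ} (h : w.HasPeriod p) :
    w.reverse.HasPeriod p := by
  rcases le_total p w.length with hp | hp
  · obtain ⟨a, b, r, h1, h2, -, h4⟩ := h.exists_append hp
    rw [← h4, ← List.length_reverse]
    exact hasPeriod_of_append (r := r.reverse) (b := a.reverse) (by rw [h2]; simp)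
      (by rw [h1]; simp)
  · exact List.hasPeriod_of_length_le _ _ (by simpa using hp)

theorem hasPeriod_reverse {w : Word} {p : ℕ} : w.reverse.HasPeriod p ↔ w.HasPeriod p :=
  ⟨fun h => by simpa using h.reverse, fun h => h.reverse⟩

theorem _root_.List.HasPeriod.of_dvd {w : Word} {p q : ℕ} (h : w.HasPeriod p) (hd : p ∣ q) :
    w.HasPeriod q := by
  rw [List.hasPeriod_iff_getElem?]
  intro i hi
  rw [← h.getElem?_mod p i w (by omega), ← h.getElem?_mod p (i + q) w (by omega)]
  obtain ⟨k, rfl⟩ := hd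
  simp

theorem _root_.List.HasPeriod.of_take {w : Word} {p g : ℕ} (h : w.HasPeriod p) (hp : 0 < p)
    (hg : (w.take p).HasPeriod g) (hd : g ∣ p) : w.HasPeriod g := by
  rw [List.hasPeriod_iff_forall_getElem?_mod]
  intro i hi
  have h1 := h.getElem?_mod p i w hi
  have hlt := Nat.mod_lt i hp
  have hle := Nat.mod_le i p
  have h2 := hg.getElem?_mod g (i % p) (w.take p) (by simp; omega)
  have hlt' : i % p % g < p := (Nat.mod_le _ _).trans_lt hlt
  rw [List.getElem?_take_of_lt hlt', List.getElem?_take_of_lt hlt, Nat.mod_mod_of_dvd _ hd] at h2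
  rw [← h1, ← h2]

theorem period_spec (w : Word) : 1 ≤ period w ∧ w.HasPeriod (period w) :=
  Nat.sInf_mem (s := {p : ℕ | 1 ≤ p ∧ w.HasPeriod p})
    ⟨w.length + 1, by simp, List.hasPeriod_of_length_le _ _ (by simp)⟩

theorem period_pos (w : Word) : 0 < period w := (period_spec w).1

theorem hasPeriod_period (w : Word) : w.HasPeriod (period w) := (period_spec w).2

theorem period_le {w : Word} {p : ℕ} (hp : 0 < p) (h : w.HasPeriod p) : period w ≤ p :=
  Nat.sInf_le ⟨hp, h⟩

theorem period_le_length {w : Word} (h : w ≠ []) : period w ≤ w.length :=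
  period_le (List.length_pos_iff.2 h) (List.hasPeriod_of_length_le _ _ le_rfl)

theorem period_reverse (w : Word) : period w.reverse = period w :=
  le_antisymm (period_le (period_pos w) (hasPeriod_period w).reverse)
    (period_le (period_pos _) (hasPeriod_reverse.1 (hasPeriod_period w.reverse)))

theorem period_add_border_le {w y : Word} (h : IsBorder y w) :
    period w + y.length ≤ w.length := by
  obtain ⟨a, ha⟩ := h.2.2.1
  obtain ⟨b, hb⟩ := h.2.2.2
  have := h.length_lt
  have e := congrArg List.length hb
  simp at e
  have := period_le (w := w) (p := b.length) (by omega) (hasPeriod_of_append hb.symm ha.symm)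
  omega

/-- An occurrence of the periodic root starts at a multiple of the period. -/
theorem period_dvd_of_occurrence {w h e : Word} (hl : period w ≤ w.length)
    (hw : w = h ++ w.take (period w) ++ e) : period w ∣ h.length := by
  set p := period w with hp
  have hpos : 0 < p := period_pos w
  set z := w.take p with hz
  have hzl : z.length = p := by simp [hz, hl]
  by_contra hd
  set m := h.length % p with hm
  have hm0 : 0 < m := Nat.pos_of_ne_zero fun h0 => hd (Nat.dvd_of_mod_eq_zero h0)
  have hmp : m < p := Nat.mod_lt _ hpos
  have hq : w.HasPeriod (h.length - m) := by
    refine (hasPeriod_period w).of_dvd ?_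
    rw [hm]; exact Nat.dvd_sub_mod _
  have hle : m ≤ h.length := Nat.mod_le _ _
  -- the factor `x` of length `m + p` starts with `z` and ends with `z`
  have hwl : h.length + p ≤ w.length := by
    have := congrArg List.length hw; simp only [List.length_append, hzl] at this; omega
  set x := h.drop (h.length - m) ++ z with hx
  have hxl : x.length = m + p := by simp [hx, hzl]; omega
  have hxw : x <+: w := by
    refine List.IsPrefix.trans ?_ hq.drop_prefix
    refine ⟨e, ?_⟩
    conv_rhs => rw [hw]
    rw [List.append_assoc h, List.drop_append_of_le_length (by omega), hx]
    simp
  have hzx : z <+: x := List.prefix_of_prefix_length_le (w.take_prefix p) hxw (by omega)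
  obtain ⟨y, hy⟩ := hzx
  have hxm : x.HasPeriod m := by
    have := hasPeriod_of_append (w := x) (a := h.drop (h.length - m)) (r := z) (b := y) rfl hy.symm
    have e : (h.drop (h.length - m)).length = m := by simp; omega
    rwa [e] at this
  have hxp : x.HasPeriod p := (hasPeriod_period w).infix hxw.isInfix
  -- Fine and Wilf: x has length m + p and periods m and p. The resulting period gcd(p, m) < p
  -- passes to the root, hence to w.
  have hg := hxp.gcd hxm (by omega)
  have h3 : w.HasPeriod (p.gcd m) := by
    refine (hasPeriod_period w).of_take hpos (hg.infix ?_) (Nat.gcd_dvd_left _ _)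
    exact (List.IsPrefix.isInfix ⟨y, hy⟩)
  have h4 := period_le (Nat.gcd_pos_of_pos_left _ hpos) h3
  have h5 := Nat.le_of_dvd hm0 (Nat.gcd_dvd_right p m)
  omega

/-! ### The decomposition `(s t)ᵏ s` -/

/-- Dividing |w| - 1 instead of |w| makes the remainder s run over lengths 1, …, p rather than 0, …,
p - 1. -/
theorem kExp_mul_add {w : Word} (h : w ≠ []) :
    0 < (sPart w).length ∧ (sPart w).length ≤ period w ∧
      kExp w * period w + (sPart w).length = w.length := by
  have hl := List.length_pos_iff.2 h
  have hp := period_pos w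
  have h1 : kExp w * period w ≤ w.length - 1 := Nat.div_mul_le_self _ _
  have h2 : w.length - 1 < kExp w * period w + period w := by
    rw [← Nat.succ_mul]
    exact Nat.lt_mul_of_div_lt (Nat.lt_succ_self _) hp
  simp only [sPart, List.length_drop]
  omega

theorem sPart_ne_nil {w : Word} (h : w ≠ []) : sPart w ≠ [] :=
  List.length_pos_iff.1 (kExp_mul_add h).1

theorem sPart_suffix (w : Word) : sPart w <:+ w := List.drop_suffix _ _

theorem sPart_prefix (w : Word) : sPart w <+: w :=
  ((hasPeriod_period w).of_dvd (Dvd.intro_left (kExp w) rfl)).drop_prefix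

theorem sPart_append_tPart {w : Word} (h : w ≠ []) :
    sPart w ++ tPart w = w.take (period w) := by
  obtain ⟨-, h1, -⟩ := kExp_mul_add h
  have h2 : sPart w <+: w.take (period w) :=
    List.prefix_of_prefix_length_le (sPart_prefix w) (List.take_prefix _ _)
      (by have := (sPart_prefix w).length_le; simp; omega)
  obtain ⟨t, ht⟩ := h2
  rw [← ht, tPart, periodicRoot, ← ht]
  simp

theorem length_sPart_add_tPart {w : Word} (h : w ≠ []) :
    (sPart w).length + (tPart w).length = period w := by
  rw [← List.length_append, sPart_append_tPart h]
  simp [period_le_length h]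

theorem sPart_append_tPart_append {w : Word} (h : w ≠ []) :
    w = sPart w ++ tPart w ++ w.drop (period w) := by
  rw [sPart_append_tPart h, List.take_append_drop]

theorem sPart_eq_of {w r : Word} {m : ℕ} (hr : r ≠ []) (hs : r <:+ w) (hle : r.length ≤ period w)
    (hm : m * period w + r.length = w.length) : sPart w = r := by
  have hw : w ≠ [] := by rintro rfl; exact hr (by simpa using hs)
  obtain ⟨h1, h2, h3⟩ := kExp_mul_add hw
  have hr' := List.length_pos_iff.2 hr
  have hp := period_pos w
  refine eq_of_suffix_of_length (sPart_suffix w) hs ?_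
  rcases lt_trichotomy (kExp w) m with h | h | h
  · have := Nat.mul_le_mul_right (period w) h
    rw [Nat.succ_mul] at this; omega
  · subst h; omega
  · have := Nat.mul_le_mul_right (period w) h
    rw [Nat.succ_mul] at this; omega

theorem tPart_eq_of {w a : Word} (h : w ≠ []) (ha : sPart w ++ a <+: w)
    (hl : (sPart w ++ a).length = period w) : tPart w = a := by
  have h1 : sPart w ++ a = sPart w ++ tPart w := by
    rw [sPart_append_tPart h]
    exact eq_of_prefix_of_length ha (List.take_prefix _ _) (by rw [hl]; simp [period_le_length h])
  exact (List.append_cancel_left h1).symm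

theorem sPart_tPart_of_drop {w : Word} (h : period w < w.length)
    (hp : period (w.drop (period w)) = period w) :
    sPart (w.drop (period w)) = sPart w ∧ tPart (w.drop (period w)) = tPart w := by
  have hw : w ≠ [] := by rintro rfl; simp at h
  have hd : w.drop (period w) ≠ [] := by simpa using h
  have hs : sPart w = sPart (w.drop (period w)) := by
    obtain ⟨h1, h2, h3⟩ := kExp_mul_add hd
    refine sPart_eq_of (m := kExp (w.drop (period w)) + 1) (sPart_ne_nil hd)
      ((sPart_suffix _).trans (List.drop_suffix _ _)) (by omega) ?_
    simp only [List.length_drop] at h3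
    rw [hp] at h3
    rw [Nat.succ_mul]; omega
  refine ⟨hs.symm, tPart_eq_of hd ?_ ?_⟩
  · rw [← hs]
    refine List.prefix_of_prefix_length_le (l₃ := w) ⟨_, (sPart_append_tPart_append hw).symm⟩
      (hasPeriod_period w).drop_prefix ?_
    have := period_le_length hd
    rw [List.length_append, length_sPart_add_tPart hw]; omega
  · rw [← hs, hp, List.length_append, length_sPart_add_tPart hw]

theorem of_period_eq_length {w : Word} (h : w ≠ []) (hp : period w = w.length) :
    sPart w = w ∧ tPart w = [] := by
  have hs : sPart w = w := sPart_eq_of (m := 0) h (List.suffix_refl _) hp.ge (by simp)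
  exact ⟨hs, tPart_eq_of h (by simp [hs]) (by simp [hs, hp])⟩

theorem drop_append_tPart_append {w : Word} (h : period w < w.length) :
    w = w.drop (period w) ++ tPart w ++ sPart w := by
  have hw : w ≠ [] := by rintro rfl; simp at h
  obtain ⟨h1, h2, h3⟩ := kExp_mul_add hw
  have hk : 1 ≤ kExp w := by
    by_contra hk
    have : kExp w = 0 := by omega
    simp [this] at h3; omega
  set p := period w with hp
  obtain ⟨x, hx⟩ := (sPart_suffix w)
  -- the suffix `y` of length `p + |s|` is also a prefix
  set y := w.drop ((kExp w - 1) * p) with hy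
  have hkp : (kExp w - 1) * p + p = kExp w * p := by
    rw [← Nat.succ_mul]; congr 1; omega
  have hyl : y.length = p + (sPart w).length := by simp [hy]; omega
  have hyp : y <+: w := ((hasPeriod_period w).of_dvd (Dvd.intro_left (kExp w - 1) rfl)).drop_prefix
  have h4 : y.take p = sPart w ++ tPart w := by
    rw [sPart_append_tPart hw]
    exact eq_of_prefix_of_length ((List.take_prefix _ _).trans hyp) (List.take_prefix _ _)
      (by simp [hyl]; omega)
  have h5 : y.drop p = sPart w := by
    rw [hy, List.drop_drop, hkp]; rfl
  have h6 : tPart w ++ sPart w <:+ w := by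
    refine List.IsSuffix.trans ⟨sPart w, ?_⟩ (List.drop_suffix ((kExp w - 1) * p) w)
    rw [← hy, ← List.take_append_drop p y, h4, h5, List.append_assoc]
  obtain ⟨z, hz⟩ := h6
  have : z = w.drop p := by
    refine eq_of_prefix_of_length ⟨_, hz⟩ (hasPeriod_period w).drop_prefix ?_
    have e := congrArg List.length hz
    have := length_sPart_add_tPart hw
    simp at e ⊢; omega
  rw [← this, List.append_assoc, hz]

theorem sPart_reverse {w : Word} (h : w ≠ []) : sPart w.reverse = (sPart w).reverse := by
  obtain ⟨-, h2, h3⟩ := kExp_mul_add h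
  exact sPart_eq_of (m := kExp w) (by simpa using sPart_ne_nil h)
    (List.reverse_suffix.2 (sPart_prefix w)) (by rw [period_reverse]; simpa using h2)
    (by rw [period_reverse]; simpa using h3)

theorem tPart_reverse {w : Word} (h : w ≠ []) : tPart w.reverse = (tPart w).reverse := by
  have hr : w.reverse ≠ [] := by simpa using h
  rcases (period_le_length h).lt_or_eq with hl | hl
  · refine tPart_eq_of hr ?_ ?_
    · rw [sPart_reverse h, ← List.reverse_append]
      refine List.reverse_prefix.2 ⟨w.drop (period w), ?_⟩
      rw [← List.append_assoc]
      exact (drop_append_tPart_append hl).symm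
    · rw [sPart_reverse h, period_reverse]
      simpa using length_sPart_add_tPart h
  · rw [(of_period_eq_length h hl).2, (of_period_eq_length hr (by simp [period_reverse, hl])).2]
    rfl

/-! ### Pairs of the inductive set are fully bordered -/

theorem Sq.mono {a b v₁ v₂ w₁ w₂ : Word} (h : Sq a v₁ v₂) (h1 : v₂ ++ a <+: w₂ ++ b)
    (h2 : a ++ v₁ <:+ b ++ w₁) : Sq b w₁ w₂ := by
  obtain ⟨x, hx, h3, h4⟩ := h
  exact ⟨x, hx, h3.trans h1, h4.trans h2⟩

theorem Filled.mono {a b v : Word} (h : Filled a v) (h1 : a <+: b) (h2 : a <:+ b) :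
    Filled b v := fun v₁ v₂ e hv₁ hv₂ =>
  (h v₁ v₂ e hv₁ hv₂).mono ((List.prefix_append_right_inj _).2 h1)
    (List.suffix_append_self_iff.2 h2)

/-- The structure of `v` relative to `u` in a pair of the inductive set. -/
structure Half (u v : Word) : Prop where
  t_prefix : tPart v <+: u
  t_suffix : tPart v <:+ u
  filled : ∀ w, w <+: v → w <:+ v → Filled (tPart v) w
  border : ∀ y, y ≠ [] → y <+: u → y <:+ u → y <:+: v → y.length ≤ (tPart v).length

theorem prefix_suffix_of_period {v V y : Word} (h1 : v <+: V) (h2 : v <:+ V)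
    (hp : period V + v.length = V.length) (hy1 : y <+: V) (hy2 : y <:+ V) :
    y = V ∨ y <+: v ∧ y <:+ v := by
  rcases eq_or_ne y V with rfl | hne
  · exact .inl rfl
  rcases eq_or_ne y [] with rfl | hnil
  · exact .inr ⟨List.nil_prefix, List.nil_suffix⟩
  have := period_add_border_le ⟨hnil, hne, hy1, hy2⟩
  exact .inr ⟨List.prefix_of_prefix_length_le hy1 h1 (by omega),
    List.suffix_of_suffix_length_le hy2 h2 (by omega)⟩

/-- The length condition makes v the longest border of V. So V gains no new border that could occur
in u, except V itself, which would bring v into u. -/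
theorem Half.extend_left {u v V : Word} (hs : Sep u v) (h : Half v u) (h1 : v <+: V)
    (h2 : v <:+ V) (hp : period V + v.length = V.length) : Half V u := by
  refine ⟨h.t_prefix.trans h1, h.t_suffix.trans h2, h.filled, fun y hy h3 h4 h5 => ?_⟩
  rcases prefix_suffix_of_period h1 h2 hp h3 h4 with rfl | ⟨h6, h7⟩
  · exact absurd (h1.isInfix.trans h5) hs.right
  · exact h.border y hy h6 h7 h5

theorem Sep.extend {u v V : Word} (hs : Sep u v) (h1 : v <+: V) (h2 : v <:+ V)
    (h : ¬ u <:+: V) : Sep u V := by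
  refine ⟨fun x hx hx' => ?_, fun x hx hx' => ?_, h, fun h' => hs.right (h1.isInfix.trans h')⟩
  · rcases List.suffix_or_suffix_of_suffix hx' h2 with h3 | h3
    · exact hs.ps x hx h3
    · exact absurd (h3.isInfix.trans hx.isInfix) hs.right
  · rcases List.prefix_or_prefix_of_prefix hx' h1 with h3 | h3
    · exact hs.sp x hx h3
    · exact absurd (h3.isInfix.trans hx.isInfix) hs.right

/-! ### Rule 3: prepending the periodic root. -/

section Root
variable {v : Word}

theorem root_eq (hv : v ≠ []) : sPart v ++ tPart v ++ v = v.take (period v) ++ v := by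
  rw [sPart_append_tPart hv]

theorem root_eq_append (hv : v ≠ []) :
    sPart v ++ tPart v ++ v = v ++ (tPart v ++ sPart v) := by
  rcases (period_le_length hv).lt_or_eq with h | h
  · calc sPart v ++ tPart v ++ v
        = sPart v ++ tPart v ++ (v.drop (period v) ++ tPart v ++ sPart v) :=
          congrArg (sPart v ++ tPart v ++ ·) (drop_append_tPart_append h)
      _ = (sPart v ++ tPart v ++ v.drop (period v)) ++ (tPart v ++ sPart v) := by simp
      _ = v ++ (tPart v ++ sPart v) :=
          congrArg (· ++ (tPart v ++ sPart v)) (sPart_append_tPart_append hv).symm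
  · simp [of_period_eq_length hv h]

theorem root_length (hv : v ≠ []) :
    (sPart v ++ tPart v ++ v).length = period v + v.length := by
  rw [root_eq hv]; simp [period_le_length hv]

theorem root_period (hv : v ≠ []) : period (sPart v ++ tPart v ++ v) = period v := by
  refine le_antisymm (period_le (period_pos v) ?_) (period_le (period_pos _) ?_)
  · rw [root_eq hv]
    exact (hasPeriod_period v).take_append _ _ _ dvd_rfl (period_le_length hv)
  · exact (hasPeriod_period _).infix (List.suffix_append _ _).isInfix

theorem root_drop (hv : v ≠ []) :
    (sPart v ++ tPart v ++ v).drop (period v) = v := by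
  rw [← length_sPart_add_tPart hv, ← List.length_append, List.drop_left]

theorem root_tPart (hv : v ≠ []) : tPart (sPart v ++ tPart v ++ v) = tPart v := by
  have h := sPart_tPart_of_drop (w := sPart v ++ tPart v ++ v)
    (by rw [root_period hv, root_length hv]; have := List.length_pos_iff.2 hv; omega)
    (by rw [root_period hv, root_drop hv])
  rw [root_period hv, root_drop hv] at h
  exact h.2.symm

/-- An occurrence crossing the boundary would make a suffix of u a prefix of v. -/
theorem Sep.infix_take_append {u y : Word} {n : ℕ} (hs : Sep u v) (hy : y <:+ u)
    (h : y <:+: v.take n ++ v) : y <:+: v := by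
  rcases List.infix_append_iff_ne_nil.1 h with h | h | ⟨c, d, -, hd, rfl, -, h⟩
  · exact h.trans (List.take_prefix _ _).isInfix
  · exact h
  · exact absurd (hs.sp d ((List.suffix_append _ _).trans hy) h) hd

theorem Half.root {u : Word} (hs : Sep u v) (h : Half u v) :
    Half u (sPart v ++ tPart v ++ v) := by
  have hv := hs.right_ne_nil
  have hpl := length_sPart_add_tPart hv
  have ht := root_tPart hv
  refine ⟨by rw [ht]; exact h.t_prefix, by rw [ht]; exact h.t_suffix, fun w h1 h2 => ?_,
    fun y hy h1 h2 h3 => ?_⟩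
  · rw [ht]
    rcases prefix_suffix_of_period ⟨_, (root_eq_append hv).symm⟩ (List.suffix_append _ _)
      (by rw [root_period hv, root_length hv]) h1 h2 with rfl | ⟨h3, h4⟩
    swap; · exact h.filled w h3 h4
    intro w₁ w₂ e hw₁ hw₂
    have hw₁' := List.length_pos_iff.2 hw₁
    have hw₂' := List.length_pos_iff.2 hw₂
    rcases lt_or_ge (sPart v ++ tPart v).length w₁.length with hl | hl
    · obtain ⟨o, ho, rfl, hv'⟩ := append_overlap e.symm hl
      exact (h.filled v (List.prefix_refl _) (List.suffix_refl _) o w₂ hv' ho hw₂).mono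
        (List.prefix_refl _) ⟨tPart v ++ sPart v, by simp⟩
    · rcases lt_or_ge w₁.length v.length with hl' | hl'
      · rw [root_eq_append hv] at e
        obtain ⟨o, ho, hv', rfl⟩ := append_overlap e hl'
        exact (h.filled v (List.prefix_refl _) (List.suffix_refl _) w₁ o hv' hw₁ ho).mono
          ⟨sPart v ++ tPart v, by simp⟩ (List.suffix_refl _)
      -- The cut lies in neither border copy of v only when the word is v v and the cut is its
      -- middle.
      · have hpv : period v = v.length := by
          have := period_le_length hv
          simp at hl; omega
        obtain ⟨hs', ht'⟩ := of_period_eq_length hv hpv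
        rw [hs', ht'] at e
        simp only [List.append_nil] at e
        obtain ⟨rfl, rfl⟩ := List.append_inj e (by
          simp at hl; omega)
        exact ⟨v, hv, List.prefix_append _ _, List.suffix_append _ _⟩
  · rw [ht]
    rw [root_eq hv] at h3
    exact h.border y hy h1 h2 (hs.infix_take_append h2 h3)

end Root

/-! ### Rule 4: inserting a border of u between two copies of v. -/

section BorderStep
variable {u v y : Word}

theorem Sep.infix_cases {x : Word} (hs : Sep u v) (h1 : x <+: u) (h2 : x <:+ u)
    (h : x <:+: v ++ y ++ v) : x <:+: v ∨ x <:+: y := by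
  rcases List.infix_append_iff_ne_nil.1 h with h | h | ⟨c, d, -, hd, rfl, -, h⟩
  · rcases List.infix_append_iff_ne_nil.1 h with h | h | ⟨c, d, hc, -, rfl, h, -⟩
    · exact .inl h
    · exact .inr h
    · exact absurd (hs.ps c ((List.prefix_append _ _).trans h1) h) hc
  · exact .inl h
  · exact absurd (hs.sp d ((List.suffix_append _ _).trans h2) h) hd

/-- A shorter period moves the word so that either part of y meets the beginning of v, or the block
y lands inside v or across its end. Overlaps contradict `Sep`; y inside v contradicts the maximality
of t_v, because y is longer. -/
theorem border_period (hs : Sep u v) (h : Half u v) (hy : IsBorder y u)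
    (hl : (tPart v).length < y.length) : period (v ++ y ++ v) = (v ++ y).length := by
  have hv := hs.right_ne_nil
  have hv' := List.length_pos_iff.2 hv
  have hper : (v ++ y ++ v).HasPeriod (v ++ y).length :=
    hasPeriod_of_append (r := v) (b := y ++ v) rfl (by simp)
  have hle : period (v ++ y ++ v) ≤ (v ++ y).length := period_le (by simp; omega) hper
  refine le_antisymm hle ?_
  by_contra hlt
  push Not at hlt
  have hpos := period_pos (v ++ y ++ v)
  obtain ⟨a, b, r, h1, h2, ha, -⟩ := (hasPeriod_period (v ++ y ++ v)).exists_append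
    (by simp at hle ⊢; omega)
  obtain ⟨c, hc, hc1, rfl⟩ := append_overlap h1 (by omega)
  rcases le_or_gt v.length a.length with hva | hva
  · obtain ⟨a', rfl, rfl⟩ := append_overlap_le hc1.symm hva
    have h3 : c <+: v ++ (a' ++ c ++ v) := ⟨v ++ b, by simpa using h2.symm⟩
    have h4 : c <:+ u := (List.suffix_append _ _).trans hy.2.2.2
    rcases List.prefix_or_prefix_of_prefix h3 (List.prefix_append v _) with h5 | h5
    · exact hc (hs.sp c h4 h5)
    · exact hs.right (h5.isInfix.trans h4.isInfix)
  · obtain ⟨m, hm, hvm, rfl⟩ := append_overlap hc1 hva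
    have h3 : m ++ y <+: v ++ (y ++ v) := ⟨v ++ b, by simpa using h2.symm⟩
    rcases prefix_append_cases h3 with h4 | ⟨d, -, h4, -⟩
    · have := h.border y hy.1 hy.2.2.1 hy.2.2.2
        (List.IsInfix.trans (List.suffix_append _ _).isInfix h4.isInfix)
      omega
    · have hmv : m.length < v.length := by rw [hvm]; simp; omega
      obtain ⟨y', hy', h5, h6⟩ := append_overlap h4.symm hmv
      refine hy' (hs.ps y' ?_ ⟨m, h5.symm⟩)
      exact List.IsPrefix.trans ⟨d, h6.symm⟩ hy.2.2.1

theorem border_tPart (hs : Sep u v) (h : Half u v) (hy : IsBorder y u)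
    (hl : (tPart v).length < y.length) : tPart (v ++ y ++ v) = y := by
  have hv := hs.right_ne_nil
  have hp := border_period hs h hy hl
  have h1 : sPart (v ++ y ++ v) = v :=
    sPart_eq_of (m := 1) hv (List.suffix_append _ _) (by rw [hp]; simp) (by rw [hp]; simp; omega)
  exact tPart_eq_of (by simp [hv]) (by rw [h1]; exact List.prefix_append _ _) (by rw [h1, hp])

/-- Squares at cuts inside v persist because t_v is a prefix and a suffix of y. Cuts inside y are
handled by the other half of the invariant: it covers every border of u, and t_u is a prefix and a
suffix of v. The two junctions are centres of y v and v y. -/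
theorem Half.borderStep (hs : Sep u v) (h : Half u v) (h' : Half v u) (hy : IsBorder y u)
    (hl : (tPart v).length < y.length) : Half u (v ++ y ++ v) := by
  have hv := hs.right_ne_nil
  have hp := border_period hs h hy hl
  have ht := border_tPart hs h hy hl
  have ht1 : tPart v <+: y := List.prefix_of_prefix_length_le h.t_prefix hy.2.2.1 hl.le
  have ht2 : tPart v <:+ y := List.suffix_of_suffix_length_le h.t_suffix hy.2.2.2 hl.le
  have hfv := h.filled v (List.prefix_refl _) (List.suffix_refl _)
  refine ⟨by rw [ht]; exact hy.2.2.1, by rw [ht]; exact hy.2.2.2, fun w h1 h2 => ?_,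
    fun z hz h1 h2 h3 => ?_⟩
  · rw [ht]
    rcases prefix_suffix_of_period (v := v) ⟨y ++ v, by simp⟩ (List.suffix_append _ _)
      (by rw [hp]; simp; omega) h1 h2 with rfl | ⟨h3, h4⟩
    swap; · exact (h.filled w h3 h4).mono ht1 ht2
    intro w₁ w₂ e hw₁ hw₂
    rcases lt_or_ge w₁.length (v ++ y).length with hlt | hge
    · obtain ⟨m, hm, e1, rfl⟩ := append_overlap e hlt
      rcases lt_trichotomy w₁.length v.length with h3 | h3 | h3
      · obtain ⟨n, hn, rfl, rfl⟩ := append_overlap e1 h3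
        exact (hfv w₁ n rfl hw₁ hn).mono
          (by simpa using ht1.trans (List.prefix_append _ _))
          (List.suffix_append_self_iff.2 ht2)
      · obtain ⟨rfl, rfl⟩ := List.append_inj e1 h3.symm
        exact ⟨y ++ v, by simp [hv], List.prefix_append _ _, List.suffix_refl _⟩
      · obtain ⟨n, hn, rfl, rfl⟩ := append_overlap e1.symm h3
        refine (h'.filled _ hy.2.2.1 hy.2.2.2 n m rfl hn hm).mono ?_ ?_
        · simpa using h'.t_prefix.trans (List.prefix_append _ _)
        · obtain ⟨q, hq⟩ := h'.t_suffix
          exact ⟨n ++ m ++ q, by rw [← hq]; simp⟩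
    · obtain ⟨m, rfl, hv'⟩ := append_overlap_le e.symm hge
      rcases eq_or_ne m [] with rfl | hm
      · obtain rfl : v = w₂ := by simpa using hv'
        exact ⟨v ++ y, by simp [hv], List.prefix_refl _, by simp⟩
      · refine (hfv m w₂ hv' hm hw₂).mono (by simpa using ht1) ?_
        obtain ⟨q, hq⟩ := ht2
        exact ⟨y ++ v ++ q, by
          conv_rhs => rw [← hq]
          simp [← hq]⟩
  · rw [ht]
    rcases hs.infix_cases h1 h2 h3 with h4 | h4
    · exact (h.border z hz h1 h2 h4).trans hl.le
    · exact h4.length_le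

end BorderStep

theorem InF.inv {u v : Word} (h : InF u v) : Sep u v ∧ Half u v ∧ Half v u := by
  induction h with
  | base =>
    have ht : ∀ x : Fin 2, tPart [x] = [] := fun x =>
      (of_period_eq_length (by simp) (le_antisymm (period_le_length (w := [x]) (by simp))
        (period_pos [x]))).2
    have hf : ∀ x y : Fin 2, x ≠ y → Half [x] [y] := fun x y hxy => by
      refine ⟨by simp [ht], by simp [ht], fun w hw _ w₁ w₂ e h1 h2 => ?_, fun z hz h1 _ h3 => ?_⟩
      · have := hw.length_le
        have := List.length_pos_iff.2 h1
        have := List.length_pos_iff.2 h2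
        subst e
        simp at *; omega
      · have hzl : z = [x] := h1.eq_of_length
          (le_antisymm h1.length_le (List.length_pos_iff.2 hz))
        subst hzl
        have := h3.eq_of_length (by simp)
        simp at this
        exact absurd this hxy
    refine ⟨⟨fun x h1 h2 => ?_, fun x h1 h2 => ?_, fun h => ?_, fun h => ?_⟩,
      hf 0 1 (by decide), hf 1 0 (by decide)⟩
    · by_contra hx
      have h3 := h1.eq_of_length (le_antisymm h1.length_le (List.length_pos_iff.2 hx))
      have h4 := h2.eq_of_length (le_antisymm h2.length_le (List.length_pos_iff.2 hx))
      rw [h3] at h4; simp at h4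
    · by_contra hx
      have h3 := h1.eq_of_length (le_antisymm h1.length_le (List.length_pos_iff.2 hx))
      have h4 := h2.eq_of_length (le_antisymm h2.length_le (List.length_pos_iff.2 hx))
      rw [h3] at h4; simp at h4
    · have := h.eq_of_length rfl; simp at this
    · have := h.eq_of_length rfl; simp at this
  | swap _ ih => exact ⟨ih.1.symm, ih.2.2, ih.2.1⟩
  | @root u v _ ih =>
    obtain ⟨hs, h1, h2⟩ := ih
    have hu := hs.left_ne_nil
    have hpre : u <+: sPart u ++ tPart u ++ u := ⟨_, (root_eq_append hu).symm⟩
    refine ⟨(hs.symm.extend hpre (List.suffix_append _ _) fun h => ?_).symm,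
      h1.extend_left hs.symm hpre (List.suffix_append _ _) (by rw [root_period hu, root_length hu]),
      h2.root hs.symm⟩
    rw [root_eq hu] at h
    exact hs.right (hs.symm.infix_take_append (List.suffix_refl _) h)
  | @border u v y _ hy hl ih =>
    obtain ⟨hs, h1, h2⟩ := ih
    have hpre : v <+: v ++ y ++ v := ⟨y ++ v, by simp⟩
    refine ⟨hs.extend hpre (List.suffix_append _ _) fun h => ?_, h1.borderStep hs h2 hy hl,
      h2.extend_left hs hpre (List.suffix_append _ _) (by rw [border_period hs h1 hy hl]; simp; omega)⟩
    rcases hs.infix_cases (List.prefix_refl _) (List.suffix_refl _) h with h | h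
    · exact hs.left h
    · have := h.length_le
      have := hy.length_lt
      omega

theorem InF.fullyBorderedPair {u v : Word} (h : InF u v) : FullyBorderedPair u v := by
  obtain ⟨hs, h1, h2⟩ := h.inv
  exact fullyBorderedPair_of_sep hs
    ((h1.filled v (List.prefix_refl _) (List.suffix_refl _)).mono h1.t_prefix h1.t_suffix)
    ((h2.filled u (List.prefix_refl _) (List.suffix_refl _)).mono h2.t_prefix h2.t_suffix)

/-! ### The periodic structure of a component -/

theorem exists_max_suffix (c : Fin 2) (v : Word) :
    ∃ v₁ v₂, v = v₁ ++ v₂ ∧ ∀ w, w <:+ v → Dom c v₂ w := by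
  obtain ⟨m, hm, hmax⟩ := exists_dom_max c (L := v.tails)
    (List.ne_nil_of_mem ((List.mem_tails _ _).2 (List.suffix_refl v)))
  obtain ⟨q, hq⟩ := (List.mem_tails _ _).1 hm
  exact ⟨q, m, hq.symm, fun w hw => hmax w ((List.mem_tails _ _).2 hw)⟩

theorem Dom.cons_of_mem {c : Fin 2} {v v₂ : Word} (hc : c ∈ v) (h : ∀ w, w <:+ v → Dom c v₂ w) :
    [c] <+: v₂ := by
  obtain ⟨s, t, rfl⟩ := List.append_of_mem hc
  have := h (c :: t) (List.suffix_append _ _)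
  rcases v₂ with _ | ⟨x, v₂⟩
  · simp at this
  · obtain rfl := Dom.head this
    simp

/-- Otherwise x v₂ is a suffix of v, so v₂ dominates x v₂. Cancelling the common prefix contradicts
the maximality of v₂, or makes v₂ dominate a proper extension of itself. -/
theorem not_suffix_left_of_max {c : Fin 2} {u v₁ v₂ x : Word}
    (hmax : ∀ w, w <:+ v₁ ++ v₂ → Dom c v₂ w) (hx : x ≠ []) (h1 : x <+: v₂ ++ u) :
    ¬ x <:+ v₁ := by
  rintro ⟨q, rfl⟩
  have h2 := hmax (x ++ v₂) ⟨q, by simp⟩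
  rcases prefix_append_cases h1 with ⟨w, rfl⟩ | ⟨e, he, rfl, -⟩
  · rw [Dom.append_left_iff] at h2
    have h3 := hmax w ⟨q ++ x ++ x, by simp⟩
    have := congrArg List.length (h2.antisymm h3)
    simp [hx] at this
  · have h3 : Dom c (v₂ ++ []) (v₂ ++ (e ++ v₂)) := by simpa using h2
    rw [Dom.append_left_iff] at h3
    simp [he] at h3

/-- The two situations in which a long local square is impossible. -/
def Dominated (u v : Word) : Prop :=
  u.length ≤ v.length ∨ ∀ y, IsBorder y u → y <:+: v

theorem Dominated.reverse {u v : Word} (h : Dominated u v) : Dominated u.reverse v.reverse := by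
  rcases h with h | h
  · exact .inl (by simpa using h)
  · refine .inr fun y hy => ?_
    have := h y.reverse (by simpa using hy.reverse)
    simpa using List.reverse_infix.2 this

/-- If p ended inside b, the rest of b, a suffix of u, would be a prefix of v by periodicity. -/
theorem Sep.length_le_of_hasPeriod {u v v₁ b V : Word} {p : ℕ} (hs : Sep u v)
    (hv : v = v₁ ++ b ++ V) (hbu : b <:+ u) (hpv : v.HasPeriod p) (hp : v₁.length < p) :
    (v₁ ++ b).length ≤ p := by
  by_contra hlt
  push Not at hlt
  have h4 : v = (v₁ ++ b.take (p - v₁.length)) ++ (b.drop (p - v₁.length) ++ V) := by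
    rw [hv]
    simp only [List.append_assoc, List.append_cancel_left_eq]
    rw [← List.append_assoc, List.take_append_drop]
  have h5 : v.drop p = b.drop (p - v₁.length) ++ V := by
    conv_lhs => rw [h4]
    refine List.drop_left' ?_
    simp at hlt ⊢; omega
  have h6 := hs.sp (b.drop (p - v₁.length)) ((List.drop_suffix _ _).trans hbu)
    ((List.prefix_append _ V).trans (h5 ▸ hpv.drop_prefix))
  simp at h6 hlt; omega

/-! ### Critical squares at a lexicographically maximal suffix. -/

section Extremal
variable {c d : Fin 2} {u v : Word}

/-- A square around the maximal suffix does not cover all of `v`. -/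
theorem Extremal.no_long_square (hs : Sep u v) (he : Extremal c d u v) (hd : Dominated u v)
    {v₁ v₂ e : Word} (hv : v = v₁ ++ v₂) (h1 : v₁ ≠ []) (h2 : v₂ ≠ [])
    (hmax : ∀ w, w <:+ v → Dom c v₂ w) (hpre : e ++ v₁ <+: u) (hsuf : v₂ ++ e <:+ u)
    (hu : Unbordered (v₂ ++ e ++ v₁)) : False := by
  have h1' := List.length_pos_iff.2 h1
  have h2' := List.length_pos_iff.2 h2
  have he0 : e ≠ [] := by
    rintro rfl
    have h3 : [c] <+: v₁ := List.prefix_of_prefix_length_le he.left_head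
      (by simpa using hpre) h1'
    have h4 : [d] <+: v₁ := List.prefix_of_prefix_length_le he.right_head
      (by rw [hv]; exact List.prefix_append _ _) h1'
    have := eq_of_prefix_of_length h3 h4 rfl
    simp at this
    exact he.ne this
  have he0' := List.length_pos_iff.2 he0
  rcases hd with hd | hd
  · obtain ⟨o, ho, -, h3, h4⟩ := exists_overlap hpre hsuf (by
      have := congrArg List.length hv
      simp only [List.length_append] at this ⊢; omega)
    refine hu o ⟨ho, fun e' => ?_, h4.trans (List.prefix_append _ _),
      h3.trans ⟨v₂, by simp⟩⟩
    have := h3.length_le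
    rw [e'] at this
    simp only [List.length_append] at this; omega
  · have hb : IsBorder e u := ⟨he0, fun e' => by
        have := hpre.length_le; rw [← e'] at this; simp at this; exact h1 this,
      (List.prefix_append _ _).trans hpre, (List.suffix_append _ _).trans hsuf⟩
    obtain ⟨α, β, hαβ⟩ := hd e hb
    -- In the order of c, u v ≥ v₂ u v₁ ≥ v₂ ≥ e β, and e begins both ends of the chain; so e begins
    -- v₂.
    have hrot : Dom c (u ++ v) (v₂ ++ u ++ v₁) := he.left_max _ (by
      have : v₂ ++ (u ++ v₁) ~r (u ++ v₁) ++ v₂ := List.isRotated_append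
      simpa [hv] using this)
    have h3 : e <+: v₂ := by
      refine Dom.eq_of_squeeze (c := c) (A := u ++ v) (B := e ++ β)
        (hrot.trans (Dom.of_prefix ⟨u ++ v₁, by simp⟩)) (hmax _ ⟨α, by simpa using hαβ⟩)
        (hb.2.2.1.trans (List.prefix_append _ _)) (List.prefix_append _ _)
    obtain ⟨m, rfl⟩ := h3
    have h4 : Dom c v₁ (m.take v₁.length) := by
      obtain ⟨r, hr⟩ := hpre
      have : Dom c (e ++ (v₁ ++ (r ++ v))) (e ++ (m ++ (u ++ v₁))) := by
        have e1 : u ++ v = e ++ (v₁ ++ (r ++ v)) := by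
          conv_lhs => rw [← hr]
          simp
        rw [← e1]; simpa using hrot
      rw [Dom.append_left_iff] at this
      exact this.trunc (List.prefix_append _ _)
        ((List.take_prefix _ _).trans (List.prefix_append _ _)) (by simp)
    have h5 : Dom d v₁ (m.take v₁.length) := by
      have := he.right_max (m ++ (u ++ (v₁ ++ e))) (by
        have : m ++ (u ++ (v₁ ++ e)) ~r (u ++ (v₁ ++ e)) ++ m := List.isRotated_append
        simpa [hv] using this)
      refine this.trunc ⟨e ++ m ++ u, by simp [hv]⟩
        ((List.take_prefix _ _).trans (List.prefix_append _ _)) (by simp)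
    have h6 := Dom.prefix_of_dom he.ne h4 h5
    rcases le_total m.length v₁.length with hl | hl
    · rw [List.take_of_length_le hl] at h6
      refine h2 (hs.ps (e ++ m) ?_ ⟨v₁, hv.symm⟩)
      exact ((List.prefix_append_right_inj e).2 h6).trans hpre
    · have h7 : v₁ <+: m := by
        rw [← h6.eq_of_length (by simp [hl])]
        exact List.take_prefix _ _
      refine hu (e ++ v₁) ⟨by simp [he0], fun e' => ?_, ?_, ⟨e ++ m, by simp⟩⟩
      · have := congrArg List.length e'
        simp at this; omega
      · exact ((List.prefix_append_right_inj e).2 h7).trans ⟨e ++ v₁, by simp⟩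

/-- The shortest square at the cut before the maximal suffix v₂ extends left into u, as x = b v₁,
but stays short on the right. So v₂ = b V, and the two orders force V to be a border of v. Thus |v₁
b| is a period. -/
theorem Extremal.exists_square (hs : Sep u v) (he : Extremal c d u v) (hf : Filled u v)
    (hd : Dominated u v) (hc : c ∈ v) :
    ∃ v₁ b V, v = v₁ ++ b ++ V ∧ v₁ ≠ [] ∧ V ≠ [] ∧ b <:+ u ∧ V <+: v ∧
      (v₁ ++ b).length = period v ∧ ∀ w, w <:+ v → Dom c (b ++ V) w := by
  obtain ⟨v₁, v₂, hv, hmax⟩ := exists_max_suffix c v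
  have hhead := Dom.cons_of_mem hc hmax
  have h2 : v₂ ≠ [] := by rintro rfl; simp at hhead
  have h1 : v₁ ≠ [] := by
    rintro rfl
    rw [List.nil_append] at hv
    subst hv
    have := eq_of_prefix_of_length hhead he.right_head rfl
    simp at this
    exact he.ne this
  have h1' := List.length_pos_iff.2 h1
  obtain ⟨x, hx, hx1, hx2, hxu⟩ := (hf v₁ v₂ hv h1 h2).exists_unbordered
  rcases suffix_append_cases hx2 with h3 | ⟨b, hb, rfl, hbu⟩
  · exact absurd h3 (not_suffix_left_of_max (hv ▸ hmax) hx hx1)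
  rcases lt_or_ge b.length v₂.length with hl | hl
  swap
  · obtain ⟨r, hr⟩ := hx1
    obtain ⟨e, rfl, h4⟩ := append_overlap_le ((List.append_assoc _ _ _).symm.trans hr) hl
    exact (he.no_long_square hs hd hv h1 h2 hmax ⟨r, by rw [h4]; simp⟩ hbu hxu).elim
  have hbv : b <+: v₂ := List.prefix_of_prefix_length_le
    ((List.prefix_append _ _).trans hx1) (List.prefix_append _ _) hl.le
  obtain ⟨V, rfl⟩ := hbv
  have hV : V ≠ [] := by rintro rfl; simp at hl
  have hVs : V <:+ v := ⟨v₁ ++ b, by simp [hv]⟩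
  have hVv : V <+: v := by
    rw [List.append_assoc, List.prefix_append_right_inj] at hx1
    rcases prefix_append_cases hx1 with ⟨V', rfl⟩ | ⟨e, -, h4, -⟩
    · refine Dom.prefix_of_dom he.ne ?_ ?_
      · rw [hv, Dom.append_left_iff]
        exact hmax _ ((List.suffix_append _ _).trans hVs)
      · have := he.right_max (v₁ ++ V' ++ (u ++ (v₁ ++ b))) (by
          have : v₁ ++ V' ++ (u ++ (v₁ ++ b)) ~r (u ++ (v₁ ++ b)) ++ (v₁ ++ V') :=
            List.isRotated_append
          simpa [hv] using this)
        exact this.trunc (List.prefix_append _ _) (List.prefix_append _ _) hVs.length_le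
    · rw [hv]
      exact (List.IsPrefix.trans ⟨e, h4.symm⟩ (List.prefix_append _ _))
  refine ⟨v₁, b, V, by simp [hv], h1, hV, hbu, hVv, ?_, hmax⟩
  obtain ⟨W, hW⟩ := hVv
  have hper : v.HasPeriod (v₁ ++ b).length :=
    hasPeriod_of_append (r := V) (b := W) (by simp [hv]) hW.symm
  refine le_antisymm ?_ (period_le (by simp; omega) hper)
  by_contra hlt
  push Not at hlt
  have hpos := period_pos v
  have hpv := hasPeriod_period v
  set p := period v
  -- A shorter period p ≤ |v₁| would extend v₂ to a longer suffix of v having v₂ as a prefix,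
  -- against maximality.
  rcases le_or_gt p v₁.length with hp | hp
  · have hx0 : (v₁.drop (v₁.length - p)).length = p := by simp; omega
    have h4 : v₁.drop (v₁.length - p) ++ (b ++ V) <:+ v := by
      rw [hv]
      exact List.suffix_append_self_iff.2 (List.drop_suffix _ _)
    have h5 : b ++ V <+: v₁.drop (v₁.length - p) ++ (b ++ V) := by
      have := (hpv.infix h4.isInfix).drop_prefix
      rwa [List.drop_left' hx0] at this
    have h6 := congrArg List.length ((hmax _ h4).antisymm (Dom.of_prefix h5))
    rw [List.length_append (bs := b ++ V), hx0] at h6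
    omega
  · exact absurd (hs.length_le_of_hasPeriod (V := V) (by simp [hv]) hbu hpv hp) (by omega)

end Extremal

/-- The periodic structure of `v` in a fully bordered pair. -/
structure Core (u v : Word) : Prop where
  lt : period v < v.length
  t_prefix : tPart v <+: u
  t_suffix : tPart v <:+ u
  border : ∀ y, y ≠ [] → y <+: u → y <:+ u → y <:+: v → y.length ≤ (tPart v).length

theorem Core.reverse {u v : Word} (h : Core u v) : Core u.reverse v.reverse := by
  have hv : v ≠ [] := by rintro rfl; simpa using h.lt
  refine ⟨by simpa [period_reverse] using h.lt, ?_, ?_, fun y hy h1 h2 h3 => ?_⟩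
  · rw [tPart_reverse hv]; exact List.reverse_prefix.2 h.t_suffix
  · rw [tPart_reverse hv]; exact List.reverse_suffix.2 h.t_prefix
  · have := h.border y.reverse (by simpa using hy)
      (List.reverse_suffix.1 (by simpa using h2)) (List.reverse_prefix.1 (by simpa using h1))
      (List.reverse_infix.1 (by simpa using h3))
    simpa [tPart_reverse hv] using this

/-- Here h a is the prefix of v whose reversal is maximal. Any suffix of u that occurs in v is
squeezed into being a suffix of h a (`key`). Applied to b, this gives b = c₀ a, and comparison in
both orders makes r = v₁ c₀ a suffix of h. Then v ends in r a r and r a is its periodic root, so s =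
r and t = a. `key` also yields the maximality of t. -/
theorem core_of_squares {c d : Fin 2} {u v v₁ b V h a v₂ : Word} (hs : Sep u v)
    (he : Extremal c d u.reverse v.reverse) (hv : v = v₁ ++ b ++ V) (hv₁ : v₁ ≠ [])
    (hbu : b <:+ u) (hp : (v₁ ++ b).length = period v)
    (hv' : v = h ++ a ++ v₂) (hv₂ : v₂ ≠ []) (hau : a <+: u) (hhv : h <:+ v)
    (hp' : (a ++ v₂).length = period v)
    (hmax : ∀ w, w <+: v → Dom c (h ++ a).reverse w.reverse) (hab : a.length ≤ b.length) :
    Core u v := by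
  have hrot : Dom c (u.reverse ++ v.reverse) (h ++ a).reverse := by
    have := he.left_max ((h ++ a).reverse ++ (u.reverse ++ v₂.reverse)) (by
      have : (h ++ a).reverse ++ (u.reverse ++ v₂.reverse) ~r
        (u.reverse ++ v₂.reverse) ++ (h ++ a).reverse := List.isRotated_append
      simpa [hv'] using this)
    exact this.trans (Dom.of_prefix (List.prefix_append _ _))
  have key : ∀ α y, y <:+ u → α ++ y <+: v → y <:+ h ++ a := by
    intro α y hy hα
    refine List.reverse_prefix.1 (Dom.eq_of_squeeze (c := c) hrot (hmax _ hα)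
      ((List.reverse_prefix.2 hy).trans (List.prefix_append _ _)) ?_)
    simp
  have hb : b <:+ h ++ a := key v₁ b hbu ⟨V, by rw [hv]⟩
  obtain ⟨c₀, rfl⟩ : a <:+ b := List.suffix_of_suffix_length_le (List.suffix_append _ _) hb hab
  have hrh : (v₁ ++ c₀) <:+ h := by
    refine List.reverse_prefix.1 (Dom.prefix_of_dom_of_prefix he.ne ?_
      (List.reverse_prefix.2 hhv) ?_)
    · have := hmax (v₁ ++ (c₀ ++ a)) ⟨V, by rw [hv]⟩
      have e : (v₁ ++ (c₀ ++ a)).reverse = a.reverse ++ (v₁ ++ c₀).reverse := by simp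
      rwa [e, List.reverse_append (as := h), Dom.append_left_iff] at this
    · have := he.right_max ((v₁ ++ c₀).reverse ++ (u.reverse ++ (a ++ V).reverse)) (by
        have : (v₁ ++ c₀).reverse ++ (u.reverse ++ (a ++ V).reverse) ~r
          (u.reverse ++ (a ++ V).reverse) ++ (v₁ ++ c₀).reverse := List.isRotated_append
        simpa [hv] using this)
      refine this.trunc (List.prefix_append _ _) (List.prefix_append _ _) ?_
      simp [hv]; omega
  generalize hr : v₁ ++ c₀ = r at hrh
  have hrv : v = r ++ a ++ V := by simp [hv, ← hr]
  have hr0 : r ≠ [] := by simp [← hr, hv₁]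
  have hra : (r ++ a).length = period v := by rw [← hp, ← hr]; simp
  obtain rfl : r = v₂ := eq_of_suffix_of_length (hrh.trans hhv) ⟨h ++ a, hv'.symm⟩ (by
    simp at hra hp'; omega)
  obtain ⟨h₀, rfl⟩ := hrh
  have hr0' := List.length_pos_iff.2 hr0
  have hv0 : v ≠ [] := by simp [hv, hv₁]
  have hz : v.take (period v) = r ++ a := by
    rw [← hra]; conv_lhs => rw [hrv]
    exact List.take_left
  have hlen : v.length = h₀.length + period v + r.length := by
    rw [← hra]; conv_lhs => rw [hv']
    simp; omega
  obtain ⟨m, hm⟩ := period_dvd_of_occurrence (w := v) (h := h₀) (e := r) (by omega)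
    (by rw [hz]; simpa using hv')
  have hsP : sPart v = r := sPart_eq_of (m := m + 1) hr0 ⟨h₀ ++ r ++ a, hv'.symm⟩
    (by rw [← hra]; simp) (by rw [hlen, hm, Nat.succ_mul, Nat.mul_comm])
  have htP : tPart v = a := tPart_eq_of hv0 (by rw [hsP]; exact ⟨V, hrv.symm⟩) (by rw [hsP, hra])
  refine ⟨by omega, by rw [htP]; exact hau, by rw [htP]; exact (List.suffix_append _ _).trans hbu,
    fun y hy h1 h2 h3 => ?_⟩
  rw [htP]
  obtain ⟨α, β, hαβ⟩ := h3
  have h4 := key α y h2 ⟨β, hαβ⟩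
  rcases suffix_append_cases h4 with h5 | ⟨y₀, hy₀, rfl, h5⟩
  · exact h5.length_le
  · exact absurd (hs.ps y₀ ((List.prefix_append _ _).trans h1) (h5.trans hhv)) hy₀

theorem core_of_not_mem {c d : Fin 2} {u v : Word} (he : Extremal c d u v) (hc : c ∉ v)
    (hl : 1 < v.length) : Core u v := by
  have hrep : v = List.replicate v.length d := by
    refine List.eq_replicate_iff.2 ⟨rfl, fun x hx => ?_⟩
    have : x ≠ c := fun e => hc (e ▸ hx)
    have := he.ne
    omega
  have hv : v ≠ [] := by rintro rfl; simp at hl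
  have hper : v.HasPeriod 1 := by
    rw [List.hasPeriod_iff_getElem?]
    intro i hi
    rw [hrep, List.getElem?_replicate, List.getElem?_replicate, if_pos (by omega),
      if_pos (by omega)]
  have hp : period v = 1 := le_antisymm (period_le one_pos hper) (period_pos v)
  have ht : tPart v = [] := by
    have h1 := length_sPart_add_tPart hv
    have h2 := (kExp_mul_add hv).1
    exact List.length_eq_zero_iff.1 (by omega)
  refine ⟨by omega, by simp [ht], by simp [ht], fun y hy h1 _ h3 => ?_⟩
  have h4 : [c] <+: y := List.prefix_of_prefix_length_le he.left_head h1
    (List.length_pos_iff.2 hy)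
  exact absurd (h3.subset (h4.subset (by simp))) hc

theorem FullyBorderedPair.core {u v : Word} (h : FullyBorderedPair u v) (hd : Dominated u v)
    (hl : 1 < v.length) : Core u v := by
  obtain ⟨c, d, he, he'⟩ := h.exists_extremal_both
  by_cases hc : c ∈ v
  swap
  · exact core_of_not_mem he hc hl
  have hs := h.sep
  obtain ⟨v₁, b, V, hv, h1, hV, hb, hVv, hp, hmax⟩ := he.exists_square hs h.filled hd hc
  obtain ⟨v₂, a, H, hv', h2, hH, ha, hHv, hp', hmax'⟩ :=
    he'.exists_square hs.reverse h.filled.reverse hd.reverse (by simpa using hc)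
  rw [period_reverse] at hp'
  have e' := congrArg List.reverse hv'
  rw [List.reverse_reverse] at e'
  rcases le_total a.length b.length with hab | hab
  · refine core_of_squares (c := c) (d := d) (h := H.reverse) (a := a.reverse) (v₂ := v₂.reverse)
      hs he' hv h1 hb hp (by simpa using e') (by simpa using h2)
      (by simpa using List.reverse_prefix.2 ha) (by simpa using List.reverse_suffix.2 hHv)
      (by simpa [add_comm] using hp') (fun w hw => ?_) (by simpa using hab)
    simpa using hmax' w.reverse (List.reverse_suffix.2 hw)
  · have := core_of_squares (c := c) (d := d) (u := u.reverse) (v := v.reverse) (v₁ := v₂) (b := a)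
      (V := H) (h := V.reverse) (a := b.reverse) (v₂ := v₁.reverse)
      hs.reverse (by simpa using he) hv' h2 ha (by rw [period_reverse, hp']) (by simp [hv])
      (by simpa using h1) (List.reverse_prefix.2 hb) (List.reverse_suffix.2 hVv)
      (by rw [period_reverse, ← hp]; simp [add_comm]) (fun w hw => ?_) (by simpa using hab)
    · simpa using this.reverse
    · have := hmax w.reverse (by simpa using List.reverse_suffix.2 hw)
      simpa using this

/-! ### Removing one period -/

theorem drop_period_prefix (v : Word) : v.drop (period v) <+: v := (hasPeriod_period v).drop_prefix

theorem drop_period_suffix (v : Word) : v.drop (period v) <:+ v := List.drop_suffix _ _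

theorem length_sPart_le_drop {v : Word} (h : period v < v.length) :
    (sPart v).length ≤ (v.drop (period v)).length := by
  have hv : v ≠ [] := by rintro rfl; simp at h
  obtain ⟨h1, h2, -⟩ := kExp_mul_add hv
  have := period_add_border_le (y := sPart v) ⟨sPart_ne_nil hv, fun e => by rw [e] at h2; omega,
    sPart_prefix v, sPart_suffix v⟩
  simp; omega

theorem drop_period_eq_or {v : Word} (h : period v < v.length) :
    v.drop (period v) = sPart v ∨
      period v + (sPart v).length ≤ (v.drop (period v)).length := by
  have hv : v ≠ [] := by rintro rfl; simp at h
  obtain ⟨h1, h2, h3⟩ := kExp_mul_add hv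
  have hlen : (v.drop (period v)).length = v.length - period v := List.length_drop
  rcases lt_trichotomy (kExp v) 1 with hk | hk | hk
  · have : kExp v = 0 := by omega
    simp [this] at h3; omega
  · left
    rw [hk] at h3
    exact eq_of_suffix_of_length (drop_period_suffix v) (sPart_suffix v) (by omega)
  · right
    have := Nat.mul_le_mul_right (period v) hk
    rw [Nat.succ_mul] at this
    omega

theorem border_prefix_drop {v y : Word} (h : IsBorder y v) : y <+: v.drop (period v) :=
  List.prefix_of_prefix_length_le h.2.2.1 (drop_period_prefix v) (by
    have := period_add_border_le h
    simp; omega)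

theorem drop_period_reverse (v : Word) :
    v.reverse.drop (period v) = (v.drop (period v)).reverse := by
  rw [List.drop_reverse]
  congr 1
  exact eq_of_prefix_of_length (List.take_prefix _ _) (drop_period_prefix v) (by simp)

/-! ### The pair obtained by deleting one period. -/

section Shrink
variable {u v : Word}

theorem Sep.shrink (hs : Sep u v) (hn : ¬ v.drop (period v) <:+: u) :
    Sep u (v.drop (period v)) :=
  ⟨fun x h1 h2 => hs.ps x h1 (h2.trans (drop_period_suffix v)),
    fun x h1 h2 => hs.sp x h1 (h2.trans (drop_period_prefix v)),
    fun h => hs.left (h.trans (drop_period_suffix v).isInfix), hn⟩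

/-- D u₁ and u₂ D cannot overlap in v, so 2|D| + |u| ≤ |v|. As |D| ≥ |v'| ≥ |s|, this gives |u| ≤
|t|, hence u = t is a factor of v. -/
theorem no_square_around (hs : Sep u v) (hC : Core u v) {u₁ u₂ D : Word} (hu : u = u₁ ++ u₂)
    (h1 : u₁ ≠ []) (h2 : u₂ ≠ []) (hpre : D ++ u₁ <+: v) (hsuf : u₂ ++ D <:+ v)
    (hl : (v.drop (period v)).length ≤ D.length) (hx : Unbordered (u₂ ++ D ++ u₁)) : False := by
  have hv := hs.right_ne_nil
  have h1' := List.length_pos_iff.2 h1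
  have h2' := List.length_pos_iff.2 h2
  have hlt := hC.lt
  have hsl := length_sPart_le_drop hlt
  have hst := length_sPart_add_tPart hv
  have hdl : (v.drop (period v)).length = v.length - period v := List.length_drop
  have hD : IsBorder D v := by
    refine ⟨List.length_pos_iff.1 (by omega), fun e => ?_, (List.prefix_append _ _).trans hpre,
      (List.suffix_append _ _).trans hsuf⟩
    have := hpre.length_le
    rw [e] at this
    simp only [List.length_append] at this; omega
  have hDl := period_add_border_le hD
  have hle : (D ++ u₁).length + (u₂ ++ D).length ≤ v.length := by
    by_contra hlt'
    push Not at hlt'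
    obtain ⟨o, ho, -, h3, h4⟩ := exists_overlap hpre hsuf hlt'
    refine hx o ⟨ho, fun e => ?_, h4.trans (List.prefix_append _ _), h3.trans ⟨u₂, by simp⟩⟩
    have := h3.length_le
    rw [e] at this
    simp only [List.length_append] at this; omega
  have hul : u.length ≤ (tPart v).length := by
    simp only [hu, List.length_append] at hle ⊢; omega
  have htu := hC.t_prefix.eq_of_length (le_antisymm hC.t_prefix.length_le hul)
  refine hs.left ?_
  rw [← htu]
  refine List.IsInfix.trans ?_ (List.take_prefix (period v) v).isInfix
  rw [← sPart_append_tPart hv]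
  exact (List.suffix_append _ _).isInfix

/-- A shortest square in v u v already lies in v' u v'. Otherwise it would place v' inside u, create
an overlap forbidden by `Sep`, or contain u wrapped around a long D, the case of `no_square_around`.
-/
theorem Filled.shrink_right (hs : Sep u v) (hC : Core u v) (hf : Filled v u)
    (hn : ¬ v.drop (period v) <:+: u) : Filled (v.drop (period v)) u := by
  intro u₁ u₂ hu h1 h2
  obtain ⟨x, hx, hx1, hx2, hxu⟩ := (hf u₁ u₂ hu h1 h2).exists_unbordered
  have hv'p := drop_period_prefix v
  have hv's := drop_period_suffix v
  have hu₁ : u₁ <+: u := ⟨u₂, hu.symm⟩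
  have hu₂ : u₂ <:+ u := ⟨u₁, hu.symm⟩
  by_contra hno
  rcases prefix_append_cases hx1 with hA | ⟨f, hf0, hxf, hfv⟩
  · rcases suffix_append_cases hx2 with hB | ⟨d, hd0, hxd, hdv⟩
    · exact hno ⟨x, hx, hA.trans (List.prefix_append _ _), hB.trans (List.suffix_append _ _)⟩
    · rcases List.suffix_or_suffix_of_suffix hdv hv's with h3 | h3
      · refine hno ⟨x, hx, hA.trans (List.prefix_append _ _), ?_⟩
        rw [hxd]; exact List.suffix_append_self_iff.2 h3
      · exact hn (h3.isInfix.trans (List.IsInfix.trans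
          (hxd ▸ (List.prefix_append d u₁).isInfix) (hA.isInfix.trans hu₂.isInfix)))
  · rcases suffix_append_cases hx2 with hB | ⟨d, hd0, hxd, hdv⟩
    · rcases List.prefix_or_prefix_of_prefix hfv hv'p with h3 | h3
      · refine hno ⟨x, hx, ?_, hB.trans (List.suffix_append _ _)⟩
        rw [hxf]; exact (List.prefix_append_right_inj _).2 h3
      · exact hn (h3.isInfix.trans (List.IsInfix.trans
          (hxf ▸ (List.suffix_append u₂ f).isInfix) (hB.isInfix.trans hu₁.isInfix)))
    · have hdf := hxd.symm.trans hxf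
      rcases le_or_gt d.length u₂.length with hl | hl
      · -- then `f` and `d` are factors of `u`, hence short
        obtain ⟨o, ho1, ho2⟩ := append_overlap_le hdf.symm hl
        have h3 : f <:+: u := List.IsInfix.trans ⟨o, [], by simp [ho2]⟩ hu₁.isInfix
        have h4 : d <:+: u := List.IsInfix.trans ⟨[], o, by simp [ho1]⟩ hu₂.isInfix
        refine hno ⟨x, hx, ?_, ?_⟩
        · rw [hxf, List.prefix_append_right_inj]
          exact (List.prefix_or_prefix_of_prefix hfv hv'p).resolve_right
            fun h => hn (h.isInfix.trans h3)
        · rw [hxd, List.suffix_append_self_iff]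
          exact (List.suffix_or_suffix_of_suffix hdv hv's).resolve_right
            fun h => hn (h.isInfix.trans h4)
      · obtain ⟨D, hD, rfl, rfl⟩ := append_overlap hdf hl
        have hlen : (v.drop (period v)).length ≤ D.length := by
          by_contra hlt
          push Not at hlt
          refine hno ⟨x, hx, ?_, ?_⟩
          · rw [hxf, List.prefix_append_right_inj]
            refine (List.prefix_or_prefix_of_prefix hfv hv'p).resolve_right fun h => ?_
            rcases prefix_append_cases h with h | ⟨c, hc, h5, h6⟩
            · have := h.length_le; omega
            · exact hc (hs.ps c (h6.trans hu₁) (List.IsSuffix.trans ⟨D, h5.symm⟩ hv's))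
          · rw [hxd, List.suffix_append_self_iff]
            refine (List.suffix_or_suffix_of_suffix hdv hv's).resolve_right fun h => ?_
            rcases suffix_append_cases h with h | ⟨c, hc, h5, h6⟩
            · have := h.length_le; omega
            · exact hc (hs.sp c (h6.trans hu₂) (List.IsPrefix.trans ⟨D, h5.symm⟩ hv'p))
        exact no_square_around hs hC hu h1 h2 hfv hdv hlen (by rw [← hxd]; exact hxu)

/-- With a full period of v on each side of the cut, periodicity supplies a square of length p. With
less on the left, a longer square violates `Sep` or brings v' into u. -/
theorem exists_short_square (hs : Sep u v) (hf : Filled u v) (hn : ¬ v.drop (period v) <:+: u)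
    {v₁ v₂ : Word} (hv : v = v₁ ++ v₂) (h1 : v₁ ≠ []) (h2 : v₂ ≠ []) (hl : period v ≤ v₂.length) :
    ∃ x, x ≠ [] ∧ x.length ≤ period v ∧ x <+: v₂ ++ u ∧ x <:+ u ++ v₁ := by
  obtain ⟨x, hx, hx1, hx2⟩ := hf v₁ v₂ hv h1 h2
  have hpos := period_pos v
  have hpv := hasPeriod_period v
  rcases le_or_gt x.length (period v) with hxp | hxp
  · exact ⟨x, hx, hxp, hx1, hx2⟩
  generalize period v = p at *
  rcases le_or_gt p v₁.length with hp | hp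
  · have hx0 : (v₁.drop (v₁.length - p)).length = p := by simp; omega
    have h4 : v₁.drop (v₁.length - p) ++ v₂ <:+ v := by
      rw [hv]
      exact List.suffix_append_self_iff.2 (List.drop_suffix _ _)
    have h5 : v₂ <+: v₁.drop (v₁.length - p) ++ v₂ := by
      have := (hpv.infix h4.isInfix).drop_prefix
      rwa [List.drop_left' hx0] at this
    refine ⟨v₁.drop (v₁.length - p), List.length_pos_iff.1 (by omega), hx0.le, ?_,
      (List.drop_suffix _ _).trans (List.suffix_append _ _)⟩
    exact (List.prefix_of_prefix_length_le (List.prefix_append _ _) h5 (by omega)).trans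
      (List.prefix_append _ _)
  · exfalso
    rcases suffix_append_cases hx2 with h3 | ⟨b, -, rfl, hbu⟩
    · have := h3.length_le; omega
    rcases prefix_append_cases ((List.prefix_append _ _).trans hx1) with ⟨V, rfl⟩ | ⟨e, -, rfl, -⟩
    · exact absurd (hs.length_le_of_hasPeriod (V := V) (by simpa using hv) hbu hpv hp)
        (by simp at hxp ⊢; omega)
    · refine hn (List.IsInfix.trans ?_ (List.IsInfix.trans (List.prefix_append v₂ e).isInfix
        hbu.isInfix))
      refine (List.suffix_of_suffix_length_le (List.drop_suffix p v) ⟨v₁, hv.symm⟩ ?_).isInfix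
      simp [hv]; omega

theorem exists_short_square' (hs : Sep u v) (hf : Filled u v) (hn : ¬ v.drop (period v) <:+: u)
    {v₁ v₂ : Word} (hv : v = v₁ ++ v₂) (h1 : v₁ ≠ []) (h2 : v₂ ≠ []) (hl : period v ≤ v₁.length) :
    ∃ x, x ≠ [] ∧ x.length ≤ period v ∧ x <+: v₂ ++ u ∧ x <:+ u ++ v₁ := by
  obtain ⟨x, hx, hxl, hx1, hx2⟩ := exists_short_square (v₁ := v₂.reverse) (v₂ := v₁.reverse)
    hs.reverse hf.reverse (by
      rw [period_reverse, drop_period_reverse]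
      simpa using hn) (by simp [hv]) (by simpa using h2) (by simpa using h1)
    (by simpa [period_reverse] using hl)
  refine ⟨x.reverse, by simpa using hx, by simpa [period_reverse] using hxl, ?_, ?_⟩
  · simpa using List.reverse_prefix.2 hx2
  · simpa using List.reverse_suffix.2 hx1

/-- Each cut w₁ | w₂ of v' is two cuts of v, namely w₁ | w₂ t s and s t w₁ | w₂. If neither short
square fits, they are w₂ t s₁ and s₂ t w₁, and their common core s₂ t s₁ is a square for v'. The
bound p on their lengths ensures that s₁ begins w₁ and s₂ ends w₂. -/
theorem Filled.shrink_left (hs : Sep u v) (hC : Core u v) (hf : Filled u v)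
    (hn : ¬ v.drop (period v) <:+: u) : Filled u (v.drop (period v)) := by
  intro w₁ w₂ hw h1 h2
  have hv := hs.right_ne_nil
  have e1 := sPart_append_tPart_append hv
  have e2 := drop_append_tPart_append hC.lt
  have hst := length_sPart_add_tPart hv
  have hsl := length_sPart_le_drop hC.lt
  have hw₁ : w₁ <+: v := List.IsPrefix.trans ⟨w₂, hw.symm⟩ (drop_period_prefix v)
  have hw₂ : w₂ <:+ v := List.IsSuffix.trans ⟨w₁, hw.symm⟩ (drop_period_suffix v)
  obtain ⟨x, hx, hxl, hx1, hx2⟩ := exists_short_square hs hf hn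
    (v₁ := w₁) (v₂ := w₂ ++ tPart v ++ sPart v) (by rw [hw] at e2; simpa using e2) h1
    (by simp [h2]) (by simp; omega)
  obtain ⟨y, hy, hyl, hy1, hy2⟩ := exists_short_square' hs hf hn
    (v₁ := sPart v ++ tPart v ++ w₁) (v₂ := w₂) (by rw [hw] at e1; simpa using e1)
    (by simp [h1]) h2 (by simp; omega)
  rw [hw] at hsl
  rcases prefix_append_cases (a := w₂ ++ tPart v) (b := sPart v ++ u) (by simpa using hx1) with
    h3 | ⟨s₁, hs₁, rfl, h4⟩
  · exact ⟨x, hx, h3.trans ((List.prefix_append_right_inj _).2 hC.t_prefix), hx2⟩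
  rcases suffix_append_cases (a := u ++ sPart v) (b := tPart v ++ w₁) (by simpa using hy2) with
    h5 | ⟨s₂, hs₂, rfl, h6⟩
  · exact ⟨y, hy, hy1, h5.trans (List.suffix_append_self_iff.2 hC.t_suffix)⟩
  simp only [List.length_append] at hxl hyl hsl
  have h7 : s₁ <+: w₁ := List.prefix_of_prefix_length_le
    ((List.prefix_of_prefix_length_le h4 (List.prefix_append _ _) (by omega)).trans
      (sPart_prefix v)) hw₁ (by omega)
  have h8 : s₂ <:+ w₂ := List.suffix_of_suffix_length_le
    ((List.suffix_of_suffix_length_le h6 (List.suffix_append _ _) (by omega)).trans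
      (sPart_suffix v)) hw₂ (by omega)
  refine ⟨s₂ ++ tPart v ++ s₁, by simp [hs₁], ?_, ?_⟩
  · refine List.IsPrefix.trans ?_ hy1
    simpa using h7
  · refine List.IsSuffix.trans ?_ hx2
    exact List.suffix_append_self_iff.2 (List.suffix_append_self_iff.2 h8)

theorem FullyBorderedPair.shrink (h : FullyBorderedPair u v) (hC : Core u v)
    (hn : ¬ v.drop (period v) <:+: u) : FullyBorderedPair u (v.drop (period v)) :=
  fullyBorderedPair_of_sep (h.sep.shrink hn) (h.filled.shrink_left h.sep hC hn)
    (h.symm.filled.shrink_right h.sep hC hn)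

theorem hasPeriod_append_tPart_append {w : Word} (h : period w < w.length) :
    (w ++ tPart w ++ w).HasPeriod (period w) := by
  have hw : w ≠ [] := by rintro rfl; simp at h
  have e1 := sPart_append_tPart_append hw
  have e2 := drop_append_tPart_append h
  have e3 := root_eq_append hw
  have := hasPeriod_of_append (w := w ++ tPart w ++ w) (a := sPart w ++ tPart w)
    (r := w.drop (period w) ++ tPart w ++ w) (b := tPart w ++ sPart w) ?_ ?_
  · rwa [List.length_append, length_sPart_add_tPart hw] at this
  · calc w ++ tPart w ++ w
        = (sPart w ++ tPart w ++ w.drop (period w)) ++ tPart w ++ w :=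
          congrArg (· ++ tPart w ++ w) e1
      _ = _ := by simp
  · calc w ++ tPart w ++ w
        = (w.drop (period w) ++ tPart w ++ sPart w) ++ tPart w ++ w :=
          congrArg (· ++ tPart w ++ w) e2
      _ = w.drop (period w) ++ tPart w ++ (sPart w ++ tPart w ++ w) := by simp
      _ = w.drop (period w) ++ tPart w ++ (w ++ (tPart w ++ sPart w)) := by rw [e3]
      _ = _ := by simp

theorem Core.tPart_drop_le (hC : Core u v) (hs' : Sep u (v.drop (period v)))
    (hH : Half u (v.drop (period v))) :
    (tPart (v.drop (period v))).length ≤ (tPart v).length := by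
  rcases eq_or_ne (tPart (v.drop (period v))) [] with h | h
  · simp [h]
  refine hC.border _ h hH.t_prefix hH.t_suffix (List.IsInfix.trans ?_
    (drop_period_suffix v).isInfix)
  refine List.IsInfix.trans ?_ (List.take_prefix (period (v.drop (period v))) _).isInfix
  rw [← sPart_append_tPart hs'.right_ne_nil]
  exact (List.suffix_append _ _).isInfix

/-- If removing a period shortens the period, only one period could be removed. -/
theorem Core.length_drop_le (hC : Core u v) (hs : Sep u v)
    (hH : Half u (v.drop (period v))) (hlt : period (v.drop (period v)) < period v)
    (hs' : Sep u (v.drop (period v))) :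
    v.drop (period v) = sPart v := by
  refine (drop_period_eq_or hC.lt).resolve_right fun hlen => ?_
  have hv := hs.right_ne_nil
  have hle := hC.tPart_drop_le hs' hH
  have hw := hs'.right_ne_nil
  have hwp := drop_period_prefix v
  have hst := length_sPart_add_tPart hv
  have hst' := length_sPart_add_tPart hw
  have hpos := period_pos v
  have htake : (v.drop (period v)).take (period v) = v.take (period v) :=
    eq_of_prefix_of_length ((List.take_prefix _ _).trans hwp) (List.take_prefix _ _) (by
      have := hwp.length_le; simp only [List.length_take]; omega)
  have hinf : v.take (period v) <:+: v.drop (period v) :=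
    htake ▸ (List.take_prefix (period v) (v.drop (period v))).isInfix
  have ht : tPart (v.drop (period v)) = tPart v := by
    refine eq_of_prefix_of_length hH.t_prefix hC.t_prefix (le_antisymm hle ?_)
    rcases eq_or_ne (tPart v) [] with h | h
    · simp [h]
    refine hH.border _ h hC.t_prefix hC.t_suffix (List.IsInfix.trans ?_ hinf)
    rw [← sPart_append_tPart hv]
    exact (List.suffix_append _ _).isInfix
  have e1 := sPart_append_tPart_append hw
  rw [ht] at hst' e1
  generalize hgw : v.drop (period v) = w at *
  -- Both periods then fit into the root of v, so Fine and Wilf applies there and contradicts the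
  -- minimality of the period of v.
  have hshort : period w ≤ (sPart v).length := by
    by_contra hgt
    push Not at hgt
    have h3 : sPart v <+: sPart w ++ tPart v :=
      List.prefix_of_prefix_length_le
        (List.prefix_of_prefix_length_le (sPart_prefix v) hwp (by omega))
        ⟨_, e1.symm⟩ (by simp; omega)
    rcases prefix_append_cases h3 with h4 | ⟨c, hc, h4, h5⟩
    · have := h4.length_le; omega
    · exact hc (hs.ps c (h5.trans hC.t_prefix)
        (List.IsSuffix.trans ⟨_, h4.symm⟩ (sPart_suffix v)))
  have hg := ((hasPeriod_period v).infix hwp.isInfix).gcd (hasPeriod_period w) (by omega)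
  have h6 := period_le (Nat.gcd_pos_of_pos_left _ hpos)
    ((hasPeriod_period v).of_take hpos (hg.infix hinf) (Nat.gcd_dvd_left _ _))
  have h7 := Nat.le_of_dvd (period_pos w) (Nat.gcd_dvd_right (period v) (period w))
  omega

/-- If the period is unchanged, s and t are unchanged too and rule 3 restores v. If it drops, then v
= v' t_v v' and rule 4 applies. There |t_{v'}| = |t_v| is impossible, since v' t_{v'} v' would keep
the shorter period of v'. -/
theorem InF.of_drop (hs : Sep u v) (hC : Core u v) (h : InF u (v.drop (period v))) : InF u v := by
  obtain ⟨hs', hH, -⟩ := h.inv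
  have hv := hs.right_ne_nil
  have hw := hs'.right_ne_nil
  have hple : period (v.drop (period v)) ≤ period v :=
    period_le (period_pos v) ((hasPeriod_period v).infix (drop_period_suffix v).isInfix)
  rcases hple.lt_or_eq with hlt | heq
  · have hsP := hC.length_drop_le hs hH hlt hs'
    have e := sPart_append_tPart_append hv
    rw [← hsP] at e
    have hle := hC.tPart_drop_le hs' hH
    rcases hle.lt_or_eq with htl | hte
    · rw [e]
      refine h.border ⟨List.length_pos_iff.1 (by omega), fun e' => hs.left ?_, hC.t_prefix,
        hC.t_suffix⟩ htl
      rw [← e']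
      exact ⟨_, _, e.symm⟩
    · exfalso
      have ht := eq_of_prefix_of_length hH.t_prefix hC.t_prefix hte
      have hst := length_sPart_add_tPart hv
      rw [← hsP] at hst
      rcases (period_le_length hw).lt_or_eq with hl | hl
      · have := hasPeriod_append_tPart_append hl
        rw [ht, ← e] at this
        have := period_le (period_pos _) this
        omega
      · have := (of_period_eq_length hw hl).2
        rw [this] at hte
        simp only [List.length_nil] at hte
        omega
  · obtain ⟨e1, e2⟩ := sPart_tPart_of_drop hC.lt heq
    have := h.swap.root.swap
    rwa [e1, e2, ← sPart_append_tPart_append hv] at this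

end Shrink

/-! ### Some component can always be shortened. -/

theorem tPart_eq_drop {u v : Word} (hs : Sep u v) (hv : Core u v) (hu : Core v u)
    (h : v.drop (period v) <:+: u) : tPart u = v.drop (period v) := by
  have hd : v.drop (period v) ≠ [] := by simpa using hv.lt
  have h1 := hu.border _ hd (drop_period_prefix v) (drop_period_suffix v) h
  refine eq_of_prefix_of_length hu.t_prefix (drop_period_prefix v) (le_antisymm ?_ h1)
  refine (border_prefix_drop ⟨List.length_pos_iff.1
    ((List.length_pos_iff.2 hd).trans_le h1), fun e => hs.right ?_, hu.t_prefix,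
    hu.t_suffix⟩).length_le
  rw [← e]
  refine List.IsInfix.trans ?_ (List.take_prefix (period u) u).isInfix
  rw [← sPart_append_tPart hs.left_ne_nil]
  exact (List.suffix_append _ _).isInfix

theorem not_unbordered_of_crossing {u v u' v' s : Word} (hu : u' ≠ [])
    (hv : v' ≠ []) (h1 : v = v' ++ u' ++ v') (h2 : u = s ++ v' ++ u') (h3 : u = u' ++ v' ++ s) :
    ¬ Unbordered (u ++ v) := by
  have e1 : u ++ v = (s ++ v') ++ (u' ++ v' ++ (u' ++ v')) := by rw [h1, h2]; simp
  rw [e1]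
  refine not_unbordered_of_comm (by simp [hv]) (by simp [hu]) ?_
  rw [← e1]
  calc u ++ v = (u' ++ v' ++ s) ++ v := by rw [← h3]
    _ = u' ++ v' ++ (s ++ v' ++ u') ++ v' := by rw [h1]; simp
    _ = u' ++ v' ++ (u' ++ v' ++ s) ++ v' := by rw [← h2, ← h3]
    _ = _ := by simp

/-- Both inclusions give t_u = v' and t_v = u'. If v' = s_v or u' = s_u, the word u v or v u is a
product of two commuting words. Otherwise each of u', v' is strictly longer than the other. -/
theorem not_both_infix {u v : Word} (hs : Sep u v) (hv : Core u v) (hu : Core v u)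
    (h1 : v.drop (period v) <:+: u) (h2 : u.drop (period u) <:+: v) : False := by
  have t1 := tPart_eq_drop hs hv hu h1
  have t2 := tPart_eq_drop hs.symm hu hv h2
  have hdv : v.drop (period v) ≠ [] := by simpa using hv.lt
  have hdu : u.drop (period u) ≠ [] := by simpa using hu.lt
  have e1 := sPart_append_tPart_append hs.left_ne_nil
  have e2 := drop_append_tPart_append hu.lt
  have e3 := sPart_append_tPart_append hs.right_ne_nil
  have e4 := drop_append_tPart_append hv.lt
  have l1 := length_sPart_add_tPart hs.left_ne_nil
  have l2 := length_sPart_add_tPart hs.right_ne_nil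
  rw [t1] at e1 e2 l1
  rw [t2] at e3 e4 l2
  rcases drop_period_eq_or hv.lt with h | h
  · rw [← h] at e4
    exact not_unbordered_of_crossing hdu hdv e4 e1 e2 hs.unbordered
  rcases drop_period_eq_or hu.lt with h' | h'
  · rw [← h'] at e2
    exact not_unbordered_of_crossing hdv hdu e2 e3 e4 hs.symm.unbordered
  have := (kExp_mul_add hs.right_ne_nil).1
  omega

theorem FullyBorderedPair.inF {u v : Word} (h : FullyBorderedPair u v) : InF u v := by
  induction hn : u.length + v.length using Nat.strong_induction_on generalizing u v with
  | _ n ih =>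
  subst hn
  wlog hle : u.length ≤ v.length generalizing u v
  · exact (this h.symm (fun m hm _ _ h' e => ih m (by omega) h' e) (by omega)).swap
  have hs := h.sep
  have hul := List.length_pos_iff.2 hs.left_ne_nil
  rcases Nat.lt_or_ge 1 v.length with hv | hv
  swap
  · obtain ⟨c, d, he⟩ := h.exists_extremal
    have h1 := he.left_head.eq_of_length (by simp; omega)
    have h2 := he.right_head.eq_of_length (by simp; omega)
    subst h1 h2
    have := he.ne
    obtain ⟨rfl, rfl⟩ | ⟨rfl, rfl⟩ : c = 0 ∧ d = 1 ∨ c = 1 ∧ d = 0 := by omega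
    · exact .base
    · exact InF.base.swap
  have hC := h.core (.inl hle) hv
  have hpv := period_pos v
  have hlt := hC.lt
  by_cases hn : v.drop (period v) <:+: u
  swap
  · exact InF.of_drop hs hC (ih _ (by simp; omega) (h.shrink hC hn) rfl)
  have hu : 1 < u.length := by
    by_contra hu
    have hd : 0 < (v.drop (period v)).length := by simpa using hlt
    have := hn.eq_of_length (le_antisymm hn.length_le (by omega))
    exact hs.left (this ▸ (drop_period_suffix v).isInfix)
  -- Since u may be shorter than v, the second alternative of `Dominated` is used: every border of v
  -- is a prefix of v', which occurs in u.
  have hC' := h.symm.core (.inr fun y hy => (border_prefix_drop hy).isInfix.trans hn) hu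
  have hpu := period_pos u
  have hlt' := hC'.lt
  have hn' : ¬ u.drop (period u) <:+: v := not_both_infix hs hC hC' hn
  exact (InF.of_drop hs.symm hC' (ih _ (by simp; omega) (h.symm.shrink hC' hn') rfl)).swap

end BinaryWord

theorem mainTheorem1 (u v : BinaryWord.Word) :
    BinaryWord.FullyBorderedPair u v ↔ BinaryWord.InF u v :=
  ⟨BinaryWord.FullyBorderedPair.inF, BinaryWord.InF.fullyBorderedPair⟩
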